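/- Let $m\ge 2$. Agents $j=1,\dots,m$ have $C^2$ cost functions $f_j:\mathbb{R}^m\to\mathbb{R}$ ($x_j\in\mathbb{R}$ is the action of agent $j$), and $f=\sum_{j=1}^m f_j$ is the social cost. Assume $(x-y)^T(\nabla f(x)-\nabla f(y))>0$ for all $x\ne y$ in $\mathbb{R}^m$ (strict convexity of $f$), and that $f$ has a minimizer $x^*\in\mathbb{R}^m$. The interference graph $\mathcal G_I$ on $\{1,\dots,m\}$ joins two distinct agents $j,k$ if and only if $f_j$ explicitly depends on $x_k$ or $f_k$ explicitly depends on $x_j$; let $\mathcal N_k$ be the set of neighbors of $k$ in $\mathcal G_I$ and $\bar{\mathcal N}_k=\mathcal N_k\cup\{k\}$, $n_k=|\bar{\mathcal N}_k|$. A communication graph $\mathcal G_C$ on $\{1,\dots,m\}$ is given by an adjacency matrix $(a^{jl})$ with $a^{jl}\ge 0$, $a^{jj}=0$, and $\mathcal G_{C_k}$ denotes its subgraph induced on $\bar{\mathcal N}_k$. Assume that $\mathcal G_I$ and all $\mathcal G_{C_k}$, $k=1,\dots,m$, are undirected and connected. Let $\bar d_j>0$ be fixed and, for $\delta>0$, consider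 for $t\ge 0$ the system $$\dot x_j=-\delta\bar d_j\,g_{jj},\qquad \dot w_{jk}=-\sum_{l\in\bar{\mathcal N}_k}a^{jl}(g_{jk}-g_{lk}),\qquad g_{jk}=w_{jk}+\frac{\partial f_j}{\partial x_k}(x),\qquad w_{jk}(0)=0,$$ for $j\in\{1,\dots,m\}$, $k\in\bar{\mathcal N}_j$. For each $k$ let $G_k=(g_{jk})_{j\in\bar{\mathcal N}_k}$, let $R_k\in\mathbb{R}^{n_k\times(n_k-1)}$ be such that $[\mathbf 1_{n_k}/\sqrt{n_k}\;\;R_k]$ is orthogonal, and put $\bar G_k=R_k^TG_k$ and $\chi=[\bar G_1^T,\dots,\bar G_m^T,(x-x^*)^T]^T$. Then there is a function $\phi\in\mathcal{KL}$ such that for each pair of positive constants $(\Delta,v)$ there is $\delta^*=\delta^*(\Delta,v)>0$ such that for every $\delta\in(0,\delta^*)$: for every initial action $x(0)$ with $\|\chi(0)\|<\Delta$ the system has a solution on $[0,\infty)$, and every solution on $[0,\infty)$ with $\|\chi(0)\|<\Delta$ satisfies $$\|\chi(t)\|\le\phi(\|\chi(0)\|,\delta t)+v\qquad\text{for all }t\ge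 0;$$ in particular the actions approach the $v$-neighborhood of the minimizer: for every $r>v$, $\|x(t)-x^*\|<r$ for all sufficiently large $t$. Here $\phi:[0,\infty)^2\to[0,\infty)$ is of class $\mathcal{KL}$ if it is continuous, $\phi(\cdot,s)$ is strictly increasing with $\phi(0,s)=0$ for each $s$, and $\phi(r,\cdot)$ is nonincreasing with limit $0$ at infinity for each $r$. -/

import Mathlib

open Filter Topology Set

namespace CoalitionGame

/-- Class `K` on `[0, ∞)`: continuous, strictly increasing, zero at zero. -/
structure IsClassK (α : ℝ → ℝ) : Prop where
  continuousOn : ContinuousOn α (Ici 0)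
  strictMonoOn : StrictMonoOn α (Ici 0)
  map_zero : α 0 = 0

/-- Class `KL` on `[0, ∞) × [0, ∞)`: (jointly) continuous, of class `K` in the first variable,
decreasing (in the weak sense) to `0` in the second one. -/
structure IsClassKL (φ : ℝ → ℝ → ℝ) : Prop where
  continuousOn : ContinuousOn (fun p : ℝ × ℝ => φ p.1 p.2) (Ici 0 ×ˢ Ici 0)
  isClassK : ∀ s, 0 ≤ s → IsClassK (fun r => φ r s)
  antitoneOn : ∀ r, 0 ≤ r → AntitoneOn (φ r) (Ici 0)
  tendsto_zero : ∀ r, 0 ≤ r → Tendsto (φ r) atTop (𝓝 0)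

/-- A weighted directed graph without self-loops, given by its adjacency matrix:
`weight i j > 0` if there is an edge from `j` to `i`, and `weight i j = 0` otherwise. -/
structure WeightedGraph (V : Type) where
  weight : Matrix V V ℝ
  nonneg : ∀ i j, 0 ≤ weight i j
  loopless : ∀ i, weight i i = 0

namespace WeightedGraph

variable {V : Type}

/-- The graph left after removing the nodes that are not in `s`. -/
def induce (A : WeightedGraph V) (s : Finset V) : WeightedGraph s where
  weight := fun i j => A.weight i j
  nonneg := fun i j => A.nonneg i j
  loopless := fun i => A.loopless i

/-- The graph is undirected: `a_ij = a_ji`. -/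
def IsUndirected (A : WeightedGraph V) : Prop :=
  ∀ i j, A.weight i j = A.weight j i

/-- There is a path along edges from every vertex to every other vertex. -/
def IsConnected (A : WeightedGraph V) : Prop :=
  ∀ i j, Relation.ReflTransGen (fun u v => 0 < A.weight v u) i j

end WeightedGraph

/-- `f` explicitly depends on the `k`-th coordinate. -/
def ExplicitlyDependsOn {m : ℕ} (f : EuclideanSpace ℝ (Fin m) → ℝ) (k : Fin m) : Prop :=
  ∃ x y : EuclideanSpace ℝ (Fin m), (∀ i, i ≠ k → x i = y i) ∧ f x ≠ f y

/-- The interference graph of the agents with cost functions `f j`. -/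
def interferenceGraph {m : ℕ} (f : Fin m → EuclideanSpace ℝ (Fin m) → ℝ) :
    SimpleGraph (Fin m) where
  Adj j k := j ≠ k ∧ (ExplicitlyDependsOn (f j) k ∨ ExplicitlyDependsOn (f k) j)
  symm := ⟨fun _ _ h => ⟨h.1.symm, h.2.symm⟩⟩
  loopless := ⟨fun _ h => h.1 rfl⟩

open Classical in
/-- The neighbors of agent `k` in the interference graph, together with `k` itself. -/
noncomputable def closedNbhd {m : ℕ} (f : Fin m → EuclideanSpace ℝ (Fin m) → ℝ) (k : Fin m) :
    Finset (Fin m) :=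
  Finset.univ.filter fun j => (interferenceGraph f).Adj k j ∨ j = k

/-- The interference-to-`k` communication graph: the part of the communication graph `A` on
the interference neighbors of `k` and `k` itself. -/
noncomputable def commGraphTo {m : ℕ} (f : Fin m → EuclideanSpace ℝ (Fin m) → ℝ)
    (A : WeightedGraph (Fin m)) (k : Fin m) : WeightedGraph (closedNbhd f k) :=
  A.induce (closedNbhd f k)

/-- The social cost `f_1 = ∑ j, f_{1j}`. -/
noncomputable def socialCost {m : ℕ} (f : Fin m → EuclideanSpace ℝ (Fin m) → ℝ)
    (x : EuclideanSpace ℝ (Fin m)) : ℝ :=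
  ∑ j, f j x

/-- The partial derivative `∂f/∂x_k` at `x`. -/
noncomputable def partialDeriv {m : ℕ} (f : EuclideanSpace ℝ (Fin m) → ℝ) (k : Fin m)
    (x : EuclideanSpace ℝ (Fin m)) : ℝ :=
  fderiv ℝ f x (EuclideanSpace.single k 1)

/-- The pseudo-gradient of the one-coalition game: the gradient of the social cost. -/
noncomputable def pseudoGradient {m : ℕ} (f : Fin m → EuclideanSpace ℝ (Fin m) → ℝ)
    (x : EuclideanSpace ℝ (Fin m)) : EuclideanSpace ℝ (Fin m) :=
  WithLp.toLp 2 fun k => partialDeriv (socialCost f) k x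

/-- The estimate `g_{jk} = w_{jk} + ∂f_j/∂x_k`. -/
noncomputable def gEst {m : ℕ} (f : Fin m → EuclideanSpace ℝ (Fin m) → ℝ)
    (x : EuclideanSpace ℝ (Fin m)) (w : Fin m → Fin m → ℝ) (j k : Fin m) : ℝ :=
  w j k + partialDeriv (f j) k x

/-- `(x, w)` is a trajectory on `[0, ∞)` of the seeking strategy with parameters
`d_j = δ * dbar j` and with `w(0) = 0`. Only the entries `w_{jk}` with `k` in the closed
interference neighborhood of `j` are used and constrained. -/
structure IsTrajectory {m : ℕ} (f : Fin m → EuclideanSpace ℝ (Fin m) → ℝ)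
    (A : WeightedGraph (Fin m)) (dbar : Fin m → ℝ) (δ : ℝ)
    (x : ℝ → EuclideanSpace ℝ (Fin m)) (w : ℝ → Fin m → Fin m → ℝ) : Prop where
  action : ∀ t, 0 ≤ t → ∀ j,
    HasDerivWithinAt (fun s => x s j) (-(δ * dbar j) * gEst f (x t) (w t) j j) (Ici 0) t
  auxiliary : ∀ t, 0 ≤ t → ∀ j, ∀ k ∈ closedNbhd f j,
    HasDerivWithinAt (fun s => w s j k)
      (-∑ l ∈ closedNbhd f k,
        A.weight j l * (gEst f (x t) (w t) j k - gEst f (x t) (w t) l k)) (Ici 0) t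
  auxiliary_zero : ∀ j, ∀ k ∈ closedNbhd f j, w 0 j k = 0

/-- The square matrix `[1/√n  R]` whose first column is the constant `1/√n`, where `n` is the
number of nodes. -/
noncomputable def augment {V : Type} [Fintype V] {n : ℕ} (R : Matrix V (Fin n) ℝ) :
    Matrix V (Unit ⊕ Fin n) ℝ :=
  Matrix.fromCols (fun _ _ => 1 / √(Fintype.card V : ℝ)) R

/-- `[1/√n  R]` is an orthogonal matrix. -/
def IsOrthogonalCompletion {V : Type} [Fintype V] [DecidableEq V] {n : ℕ}
    (R : Matrix V (Fin n) ℝ) : Prop :=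
  (augment R).transpose * augment R = 1 ∧ augment R * (augment R).transpose = 1

/-- `Ḡ_k = R_kᵀ G_k`, where `G_k` collects `g_{jk}` over `j` in the closed interference
neighborhood of `k`. -/
noncomputable def gBar {m : ℕ} (f : Fin m → EuclideanSpace ℝ (Fin m) → ℝ)
    (R : ∀ k, Matrix (closedNbhd f k) (Fin ((closedNbhd f k).card - 1)) ℝ)
    (x : EuclideanSpace ℝ (Fin m)) (w : Fin m → Fin m → ℝ) (k : Fin m) :
    Fin ((closedNbhd f k).card - 1) → ℝ :=
  (R k).transpose.mulVec fun j => gEst f x w j k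

/-- The concatenated vector `χ = [Ḡ_1ᵀ, …, Ḡ_mᵀ, (x - x*)ᵀ]ᵀ`, with the Euclidean norm. -/
noncomputable def chi {m : ℕ} (f : Fin m → EuclideanSpace ℝ (Fin m) → ℝ)
    (R : ∀ k, Matrix (closedNbhd f k) (Fin ((closedNbhd f k).card - 1)) ℝ)
    (xstar x : EuclideanSpace ℝ (Fin m)) (w : Fin m → Fin m → ℝ) :
    EuclideanSpace ℝ ((Σ k : Fin m, Fin ((closedNbhd f k).card - 1)) ⊕ Fin m) :=
  WithLp.toLp 2 (Sum.elim (fun p => gBar f R x w p.1 p.2) fun j => x j - xstar j)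

end CoalitionGame

/-! The system has two time scales: the estimates `g_{jk}` reach consensus at a rate independent of
`δ`, while the actions move at speed of order `δ`.

Symmetric weights conserve the sum of `w_{jk}` over `j` in the closed neighborhood of `k`, and that
sum starts at zero. Hence the average of the `g_{jk}` is exactly the `k`-th partial derivative of
the social cost divided by `n_k` (`IsTrajectoryOn.gMean_eq`), and only the deviations from the
average have to be controlled. By orthogonality of `[1/√n R_k]`, the squared norm of `χ` is the
total squared deviation `u` plus `‖x - x*‖²` (`norm_chi_sq`), so the matrices `R_k` disappear from
the analysis.

A Poincaré inequality on each connected communication graph gives `u' ≤ -c u + δ² K` as long as the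
state stays in a fixed ball (`disagreement_deriv_le`). For a weighted squared distance `V` to the
minimizer, `V' ≤ -2 δ a(V) + δ C √u`. Here `a` is of class `K`, obtained from strict monotonicity of
the gradient by minimizing over spheres (`exists_isClassK_le_inner`).

In `two_time_scale_bound` the transient part of `√u` has integral bounded independently of `δ`, so
it adds only `O(δ)` to `V`; the persistent part, also `O(δ)`, is absorbed by half of the decay. What
remains is compared with `V' = -δ a(V)`, giving a class `KL` bound in `δ t` that depends neither on
`Δ` nor on `v`.

The ball is justified by continuation: inside it the estimates hold with strict room to spare, so
its boundary is never reached. The same bound yields global existence after cutting off the vector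
field. -/

namespace CoalitionGame

/-! ### Construction of class `KL` bounds -/

/-- For `a` of class `K`, the solution `η = β r s` of `η + s * a η = r` is of class `KL`. -/
theorem exists_isClassKL_add_mul_eq {a : ℝ → ℝ} (ha : IsClassK a) :
    ∃ β : ℝ → ℝ → ℝ, IsClassKL β ∧
      ∀ r s, 0 ≤ r → 0 ≤ s → 0 ≤ β r s ∧ β r s + s * a (β r s) = r := by
  have hmono : MonotoneOn a (Ici 0) := ha.strictMonoOn.monotoneOn
  have hnn : ∀ η, 0 ≤ η → 0 ≤ a η := fun η hη => by
    simpa [ha.map_zero] using hmono (mem_Ici.2 le_rfl) (mem_Ici.2 hη) hη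
  have hex : ∀ r s : ℝ, ∃ η : ℝ, 0 ≤ r → 0 ≤ s → 0 ≤ η ∧ η + s * a η = r := by
    intro r s
    by_cases hr : 0 ≤ r
    · by_cases hs : 0 ≤ s
      · have hc : ContinuousOn (fun η => η + s * a η) (Icc 0 r) :=
          continuousOn_id.add (continuousOn_const.mul (ha.continuousOn.mono Icc_subset_Ici_self))
        have := intermediate_value_Icc hr hc
        obtain ⟨η, hη, h⟩ := this ⟨by simpa [ha.map_zero] using hr,
          by nlinarith [mul_nonneg hs (hnn r hr)]⟩
        exact ⟨η, fun _ _ => ⟨hη.1, h⟩⟩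
      · exact ⟨0, fun _ h => absurd h hs⟩
    · exact ⟨0, fun h => absurd h hr⟩
  choose β hβ using hex
  have hle : ∀ r s, 0 ≤ r → 0 ≤ s → β r s ≤ r := fun r s hr hs => by
    obtain ⟨h0, h1⟩ := hβ r s hr hs
    nlinarith [mul_nonneg hs (hnn _ h0)]
  have hstrict : ∀ s, 0 ≤ s → StrictMonoOn (fun r => β r s) (Ici 0) := by
    intro s hs r hr r' hr' hlt
    obtain ⟨h0, h1⟩ := hβ r s hr hs
    obtain ⟨h0', h1'⟩ := hβ r' s hr' hs
    by_contra hcon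
    have hcon' : β r' s ≤ β r s := not_lt.1 hcon
    have := mul_le_mul_of_nonneg_left (hmono (mem_Ici.2 h0') (mem_Ici.2 h0) hcon') hs
    linarith
  -- Monotonicity of `a` makes the implicit solution 1-Lipschitz in `r` and Lipschitz in `s` with
  -- constant `a r'`; joint continuity follows without differentiability of `a`.
  have hdist : ∀ r s r' s', 0 ≤ r → 0 ≤ s → 0 ≤ r' → 0 ≤ s' →
      |β r s - β r' s'| ≤ |r - r'| + |s - s'| * a r' := by
    intro r s r' s' hr hs hr' hs'
    obtain ⟨h0, h1⟩ := hβ r s hr hs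
    obtain ⟨h0', h1'⟩ := hβ r' s' hr' hs'
    have hr1 := le_abs_self (r - r')
    have hr2 := neg_abs_le (r - r')
    have hs1 := le_abs_self (s - s')
    have hs2 := neg_abs_le (s - s')
    have hl' := hle r' s' hr' hs'
    rcases le_total (β r s) (β r' s') with h | h
    · rw [abs_sub_comm, abs_of_nonneg (by linarith)]
      have e1 := mul_le_mul_of_nonneg_left (hmono (mem_Ici.2 h0) (mem_Ici.2 h0') h) hs'
      have e2 := mul_le_mul_of_nonneg_left
        (hmono (mem_Ici.2 h0) (mem_Ici.2 hr') (h.trans hl')) (abs_nonneg (s - s'))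
      have e3 := mul_le_mul_of_nonneg_right hs1 (hnn _ h0)
      nlinarith
    · rw [abs_of_nonneg (by linarith)]
      have e1 := mul_le_mul_of_nonneg_left (hmono (mem_Ici.2 h0') (mem_Ici.2 h0) h) hs
      have e2 := mul_le_mul_of_nonneg_left
        (hmono (mem_Ici.2 h0') (mem_Ici.2 hr') hl') (abs_nonneg (s - s'))
      have e3 := mul_le_mul_of_nonneg_right (neg_le.1 hs2) (hnn _ h0')
      nlinarith
  have hcont : ContinuousOn (fun p : ℝ × ℝ => β p.1 p.2) (Ici 0 ×ˢ Ici 0) := by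
    rintro ⟨r', s'⟩ ⟨hr', hs'⟩
    rw [ContinuousWithinAt, tendsto_iff_dist_tendsto_zero]
    have hlim : Tendsto (fun p : ℝ × ℝ => |p.1 - r'| + |p.2 - s'| * a r')
        (𝓝[Ici 0 ×ˢ Ici 0] (r', s')) (𝓝 0) := by
      have : Continuous (fun p : ℝ × ℝ => |p.1 - r'| + |p.2 - s'| * a r') := by fun_prop
      have h := (this.tendsto (r', s')).mono_left (nhdsWithin_le_nhds (s := Ici 0 ×ˢ Ici 0))
      simpa using h
    refine squeeze_zero' (Eventually.of_forall fun _ => dist_nonneg) ?_ hlim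
    filter_upwards [self_mem_nhdsWithin] with p hp
    exact hdist _ _ _ _ hp.1 hp.2 hr' hs'
  have hzero : ∀ s, 0 ≤ s → β 0 s = 0 := fun s hs =>
    le_antisymm (hle 0 s le_rfl hs) (hβ 0 s le_rfl hs).1
  refine ⟨β, ⟨hcont, fun s hs => ⟨?_, hstrict s hs, hzero s hs⟩, ?_, ?_⟩, fun r s => hβ r s⟩
  · exact hcont.comp (f := fun r : ℝ => (r, s)) (by fun_prop) fun r hr => ⟨hr, hs⟩
  · intro r hr s hs s' hs' hss
    obtain ⟨h0, h1⟩ := hβ r s hr hs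
    obtain ⟨h0', h1'⟩ := hβ r s' hr hs'
    by_contra! hcon
    have e1 := mul_le_mul_of_nonneg_left
      (hmono (mem_Ici.2 h0) (mem_Ici.2 h0') hcon.le) hs
    have e2 := mul_le_mul_of_nonneg_right hss (hnn _ h0')
    linarith
  · intro r hr
    rw [Metric.tendsto_atTop]
    intro ε hε
    have haε : 0 < a ε := by
      simpa [ha.map_zero] using ha.strictMonoOn (mem_Ici.2 le_rfl) (mem_Ici.2 hε.le) hε
    refine ⟨max 0 (r / a ε), fun s hs => ?_⟩
    have hs0 : 0 ≤ s := (le_max_left _ _).trans hs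
    have hs1 : r ≤ s * a ε := (div_le_iff₀ haε).1 ((le_max_right _ _).trans hs)
    obtain ⟨h0, h1⟩ := hβ r s hr hs0
    rw [Real.dist_eq, sub_zero, abs_of_nonneg h0]
    by_contra! hcon
    have e1 := mul_le_mul_of_nonneg_left
      (hmono (mem_Ici.2 hε.le) (mem_Ici.2 h0) hcon) hs0
    linarith

/-- This is the shape of the final bound: the root term controls the actions, the exponential term
the disagreement. The latter also supplies strict growth in `r`, since `K` and `c` may vanish. -/
theorem IsClassKL.const_mul_sqrt_comp_add {β : ℝ → ℝ → ℝ} (hβ : IsClassKL β) {K c : ℝ}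
    (hK : 0 ≤ K) (hc : 0 ≤ c) :
    IsClassKL fun r s => K * √(β (c * r ^ 2) s) + r * Real.exp (-s) := by
  have hcr : ∀ r : ℝ, 0 ≤ c * r ^ 2 := fun r => by positivity
  have hcont : ContinuousOn
      (fun p : ℝ × ℝ => K * √(β (c * p.1 ^ 2) p.2) + p.1 * Real.exp (-p.2))
      (Ici 0 ×ˢ Ici 0) := by
    refine ContinuousOn.add (continuousOn_const.mul (Real.continuous_sqrt.comp_continuousOn ?_))
      (by fun_prop)
    exact hβ.continuousOn.comp (f := fun p : ℝ × ℝ => (c * p.1 ^ 2, p.2)) (by fun_prop)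
      fun p hp => ⟨hcr _, hp.2⟩
  refine ⟨hcont, fun s hs => ⟨?_, ?_, ?_⟩, ?_, ?_⟩
  · exact hcont.comp (f := fun r : ℝ => (r, s)) (by fun_prop) fun r hr => ⟨hr, hs⟩
  · intro r hr r' hr' hlt
    have hr0 : (0 : ℝ) ≤ r := hr
    have h1 : c * r ^ 2 ≤ c * r' ^ 2 := by gcongr
    have h2 := Real.sqrt_le_sqrt ((hβ.isClassK s hs).strictMonoOn.monotoneOn (hcr r) (hcr r') h1)
    have h3 := mul_lt_mul_of_pos_right hlt (Real.exp_pos (-s))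
    have h4 := mul_le_mul_of_nonneg_left h2 hK
    simp only at h4 ⊢
    linarith
  · simp [(hβ.isClassK s hs).map_zero]
  · intro r hr s hs s' hs' hss
    have h1 := Real.sqrt_le_sqrt (hβ.antitoneOn _ (hcr r) hs hs' hss)
    have h2 := mul_le_mul_of_nonneg_left h1 hK
    have h3 : r * Real.exp (-s') ≤ r * Real.exp (-s) :=
      mul_le_mul_of_nonneg_left (Real.exp_le_exp.2 (by linarith)) hr
    simp only
    linarith
  · intro r hr
    have h1 := (Real.continuous_sqrt.tendsto 0).comp (hβ.tendsto_zero _ (hcr r))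
    have h2 := (h1.const_mul K).add (Real.tendsto_exp_neg_atTop_nhds_zero.const_mul r)
    simpa [Function.comp_def] using h2

/-! ### Scalar comparison and continuation -/

theorem le_exp_mul_add_of_deriv_le {u u' : ℝ → ℝ} {T c b : ℝ} (hc : 0 < c) (hb : 0 ≤ b)
    (hu : ContinuousOn u (Icc 0 T)) (hu' : ∀ t ∈ Ico 0 T, HasDerivWithinAt u (u' t) (Ici t) t)
    (h : ∀ t ∈ Ico 0 T, u' t ≤ -c * u t + b) :
    ∀ t ∈ Icc 0 T, u t ≤ Real.exp (-(c * t)) * u 0 + b / c := by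
  -- Integrating factor: `exp (c t) (u t - b / c)` has nonpositive right derivative.
  have key : ∀ ⦃t⦄, t ∈ Icc 0 T → Real.exp (c * t) * (u t - b / c) ≤ u 0 - b / c := by
    refine image_le_of_deriv_right_le_deriv_boundary (B := fun _ => u 0 - b / c)
      (B' := fun _ => 0)
      (f' := fun t => Real.exp (c * t) * c * (u t - b / c) + Real.exp (c * t) * u' t)
      ?_ ?_ (by simp) continuousOn_const (fun t _ => hasDerivWithinAt_const _ _ _) ?_
    · exact (by fun_prop : Continuous fun t => Real.exp (c * t)).continuousOn.mul
        (hu.sub continuousOn_const)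
    · intro t ht
      have h1 : HasDerivAt (fun t => Real.exp (c * t)) (Real.exp (c * t) * c) t := by
        simpa using ((hasDerivAt_id t).const_mul c).exp
      exact h1.hasDerivWithinAt.mul ((hu' t ht).sub_const _)
    · intro t ht
      have h1 := h t ht
      have h2 : c * (u t - b / c) + u' t ≤ 0 := by
        have : c * (u t - b / c) = c * u t - b := by field_simp
        linarith
      have := mul_nonpos_of_nonneg_of_nonpos (Real.exp_pos (c * t)).le h2
      linarith
  intro t ht
  have h1 := mul_le_mul_of_nonneg_left (key ht) (Real.exp_pos (-(c * t))).le
  rw [← mul_assoc, ← Real.exp_add, neg_add_cancel, Real.exp_zero, one_mul] at h1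
  have h2 : 0 ≤ Real.exp (-(c * t)) * (b / c) := by positivity
  linarith

/-- Scalar comparison for a fast variable with squared size `u` and a slow Lyapunov function `V`. -/
theorem two_time_scale_bound {a : ℝ → ℝ} (ha : IsClassK a) {β : ℝ → ℝ → ℝ}
    (hβ : ∀ r s, 0 ≤ r → 0 ≤ s → 0 ≤ β r s ∧ β r s + s * a (β r s) = r)
    {u u' V V' : ℝ → ℝ} {T δ c K C D ε : ℝ} (hδ : 0 < δ) (hc : 0 < c) (hK : 0 ≤ K) (hC : 0 ≤ C)
    (hD : 0 ≤ D) (hε : 0 < ε)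
    (hu : ContinuousOn u (Icc 0 T)) (hu' : ∀ t ∈ Ico 0 T, HasDerivWithinAt u (u' t) (Ici t) t)
    (hV : ContinuousOn V (Icc 0 T)) (hV' : ∀ t ∈ Ico 0 T, HasDerivWithinAt V (V' t) (Ici t) t)
    (hu0 : ∀ t, 0 ≤ u t) (hV0 : ∀ t, 0 ≤ V t) (huD : √(u 0) ≤ D)
    (h1 : ∀ t ∈ Ico 0 T, u' t ≤ -c * u t + δ ^ 2 * K)
    (h2 : ∀ t ∈ Ico 0 T, V' t ≤ -2 * δ * a (V t) + δ * C * √(u t))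
    (hδ1 : δ * (2 * C * D / c) ≤ ε) (hδ2 : δ * (C * √(K / c)) ≤ a ε) :
    ∀ t ∈ Icc 0 T, √(u t) ≤ √(u 0) * Real.exp (-(c / 2 * t)) + δ * √(K / c) ∧
      V t ≤ β (V 0) (δ * t) + 2 * ε := by
  have hmono : MonotoneOn a (Ici 0) := ha.strictMonoOn.monotoneOn
  have hub : ∀ t ∈ Icc 0 T, √(u t) ≤ √(u 0) * Real.exp (-(c / 2 * t)) + δ * √(K / c) := by
    intro t ht
    have h3 := le_exp_mul_add_of_deriv_le hc (by positivity) hu hu' h1 t ht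
    refine (Real.sqrt_le_sqrt h3).trans ((Real.sqrt_le_iff).2 ⟨by positivity, ?_⟩)
    have e1 : Real.exp (-(c * t)) = Real.exp (-(c / 2 * t)) ^ 2 := by
      rw [← Real.exp_nat_mul]; congr 1; push_cast; ring
    have e2 := Real.sq_sqrt (hu0 0)
    have e3 := Real.sq_sqrt (show 0 ≤ K / c by positivity)
    have e4 : 0 ≤ √(u 0) * Real.exp (-(c / 2 * t)) * (δ * √(K / c)) := by positivity
    rw [e1, add_sq, mul_pow, mul_pow, e2, e3]
    have e5 : δ ^ 2 * K / c = δ ^ 2 * (K / c) := by ring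
    rw [e5]
    nlinarith
  intro t ht
  refine ⟨hub t ht, ?_⟩
  have hδt : 0 ≤ δ * t := mul_nonneg hδ.le ht.1
  obtain ⟨hβ0, hβ1⟩ := hβ (V 0) (δ * t) (hV0 0) hδt
  set b := β (V 0) (δ * t)
  -- The final time `t` is fixed and `V` is compared with the line `η + δ (t - τ) a η`, which ends
  -- at `η`. Its initial value dominates `V 0 = b + δ t a b` because `η ≥ b`, while `η ≥ ε` lets the
  -- decay absorb the persistent error.
  set η := max ε b with hη
  have hη0 : 0 < η := hε.trans_le (le_max_left _ _)
  -- The derivative of `h` cancels the exponentially decaying part of the coupling term. As `h ≤ ε`,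
  -- replacing `V` by `V + h - ε` costs at most `ε`.
  set h : ℝ → ℝ := fun τ => δ * (2 * C * D / c) * Real.exp (-(c / 2 * τ)) with hh
  have hhle : ∀ τ, 0 ≤ τ → h τ ≤ ε := by
    intro τ hτ
    have : Real.exp (-(c / 2 * τ)) ≤ 1 := Real.exp_le_one_iff.2 (by
      have : 0 ≤ c / 2 * τ := by positivity
      linarith)
    have h0 : 0 ≤ δ * (2 * C * D / c) := by positivity
    exact (mul_le_of_le_one_right h0 this).trans hδ1
  have hh0 : ∀ τ, 0 ≤ h τ := fun τ => by positivity
  have hh' : ∀ τ, HasDerivAt h (-(δ * C * D * Real.exp (-(c / 2 * τ)))) τ := by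
    intro τ
    have := (((hasDerivAt_id τ).const_mul (c / 2)).neg.exp).const_mul (δ * (2 * C * D / c))
    refine this.congr_deriv ?_
    simp only [id, Pi.neg_apply]
    field_simp
  have hsub : Ico 0 t ⊆ Ico 0 T := Ico_subset_Ico_right ht.2
  have key := image_le_of_deriv_right_lt_deriv_boundary' (a := 0) (b := t)
    (f := fun τ => V τ + h τ - ε) (f' := fun τ => V' τ + -(δ * C * D * Real.exp (-(c / 2 * τ))))
    (B := fun τ => η + δ * (t - τ) * a η) (B' := fun τ => -(δ * a η))
    (((hV.mono (Icc_subset_Icc_right ht.2)).add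
      (fun τ _ => (hh' τ).continuousAt.continuousWithinAt)).sub continuousOn_const)
    (fun τ hτ => ((hV' τ (hsub hτ)).add (hh' τ).hasDerivWithinAt).sub_const ε)
    (by
      have e1 : a b ≤ a η := hmono (mem_Ici.2 hβ0) (mem_Ici.2 hη0.le) (le_max_right _ _)
      have e2 := mul_le_mul_of_nonneg_left e1 hδt
      have e3 := hhle 0 le_rfl
      have e4 : b ≤ η := le_max_right _ _
      simp only [sub_zero]
      linarith)
    (by fun_prop)
    (fun τ _ => by
      have := ((((hasDerivAt_id τ).const_sub t).const_mul δ).mul_const (a η)).const_add η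
      refine this.hasDerivWithinAt.congr_deriv ?_
      ring)
    -- At a contact point `V τ > η`. One copy of `δ a (V τ)` strictly beats the slope `δ a η`, the
    -- other covers the persistent coupling, at most `δ a ε`.
    (fun τ hτ heq => by
      have aη0 : 0 < a η := by
        simpa [ha.map_zero] using ha.strictMonoOn (mem_Ici.2 le_rfl) (mem_Ici.2 hη0.le) hη0
      have e0 : 0 < δ * (t - τ) * a η :=
        mul_pos (mul_pos hδ (sub_pos.2 hτ.2)) aη0
      have e1 : η < V τ := by linarith [hhle τ hτ.1]
      have e2 : a η < a (V τ) := ha.strictMonoOn (mem_Ici.2 hη0.le) (mem_Ici.2 (hV0 τ)) e1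
      have e3 : a ε ≤ a η := hmono (mem_Ici.2 hε.le) (mem_Ici.2 hη0.le) (le_max_left _ _)
      have e4 := h2 τ (hsub hτ)
      have e5 := hub τ (Ico_subset_Icc_self (hsub hτ))
      have e6 : √(u 0) * Real.exp (-(c / 2 * τ)) ≤ D * Real.exp (-(c / 2 * τ)) := by gcongr
      have e7 : δ * C * √(u τ) ≤ δ * C * (D * Real.exp (-(c / 2 * τ)) + δ * √(K / c)) := by
        gcongr; linarith
      have e8 := mul_le_mul_of_nonneg_left hδ2 hδ.le
      have e9 := mul_lt_mul_of_pos_left e2 hδ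
      have e10 := mul_le_mul_of_nonneg_left e3 hδ.le
      nlinarith)
  have hk := key (right_mem_Icc.2 ht.1)
  simp only [sub_self, mul_zero, zero_mul, add_zero] at hk
  have : η ≤ ε + b := max_le (by linarith) (by linarith)
  linarith [hh0 t]

/-- A continuity argument: a bound that improves itself on initial intervals persists. -/
theorem lt_of_forall_Icc_le_imp_lt {N : ℝ → ℝ} {T ρ : ℝ} (hN : ContinuousOn N (Icc 0 T))
    (h : ∀ t ∈ Icc 0 T, (∀ τ ∈ Icc 0 t, N τ ≤ ρ) → N t < ρ) (h0 : N 0 ≤ ρ) :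
    ∀ t ∈ Icc 0 T, N t < ρ := by
  intro t ht
  by_contra! hcon
  have hcpt : IsCompact (Icc 0 T ∩ N ⁻¹' Ici ρ) :=
    isCompact_Icc.of_isClosed_subset (hN.preimage_isClosed_of_isClosed isClosed_Icc isClosed_Ici)
      inter_subset_left
  obtain ⟨τ, ⟨hτ, hρ⟩, hmin⟩ := hcpt.exists_isLeast ⟨t, ht, hcon⟩
  have hNτ : N τ ≤ ρ := by
    by_contra! hlt
    obtain ⟨σ, hσ, hσρ⟩ := intermediate_value_Icc hτ.1 (hN.mono (Icc_subset_Icc_right hτ.2))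
      ⟨h0, hlt.le⟩
    have : τ ≤ σ := hmin ⟨⟨hσ.1, hσ.2.trans hτ.2⟩, hσρ.ge⟩
    rw [le_antisymm this hσ.2, hσρ] at hlt
    exact lt_irrefl _ hlt
  refine absurd (h τ hτ fun σ hσ => ?_) (not_lt.2 hρ)
  by_contra! hlt
  have : τ ≤ σ := hmin ⟨⟨hσ.1, hσ.2.trans hτ.2⟩, hlt.le⟩
  rw [le_antisymm hσ.2 this] at hlt
  exact absurd hNτ (not_le.2 hlt)

/-! ### Global solutions from a priori bounds -/

section GlobalSolutions

variable {E : Type*} [NormedAddCommGroup E] [NormedSpace ℝ E]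

/-- Since `‖F‖ ≤ L`, a solution cannot leave the ball of radius `L n` before time `n`, so
Picard–Lindelöf applies on all of `[0, n]` at once; uniqueness glues the pieces. -/
theorem exists_solution_of_lipschitzWith_of_bounded [CompleteSpace E] {F : E → E} {K : NNReal}
    (hK : LipschitzWith K F) {L : ℝ} (hL : ∀ z, ‖F z‖ ≤ L) (z₀ : E) :
    ∃ z : ℝ → E, z 0 = z₀ ∧ ∀ t, 0 ≤ t → HasDerivWithinAt z (F (z t)) (Ici 0) t := by
  have hL0 : 0 ≤ L := (norm_nonneg _).trans (hL z₀)
  have hex : ∀ n : ℕ, ∃ z : ℝ → E, z 0 = z₀ ∧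
      ∀ t ∈ Icc (0 : ℝ) n, HasDerivWithinAt z (F (z t)) (Icc (0 : ℝ) n) t := by
    intro n
    have hn : (0 : ℝ) ≤ n := n.cast_nonneg
    have hPL : IsPicardLindelof (fun _ => F) (⟨0, le_rfl, hn⟩ : Icc (0 : ℝ) n) z₀
        (L.toNNReal * n) 0 L.toNNReal K :=
      { lipschitzOnWith := fun _ _ => hK.lipschitzOnWith
        continuousOn := fun _ _ => continuousOn_const
        norm_le := fun _ _ z _ => by rw [Real.coe_toNNReal _ hL0]; exact hL z
        mul_max_le := by simp }
    exact hPL.exists_eq_forall_mem_Icc_hasDerivWithinAt₀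
  choose z hz0 hz using hex
  have hcont : ∀ n : ℕ, ContinuousOn (z n) (Icc 0 n) := fun n t ht =>
    (hz n t ht).continuousWithinAt
  have hright : ∀ n : ℕ, ∀ t ∈ Ico (0 : ℝ) n, HasDerivWithinAt (z n) (F (z n t)) (Ici t) t :=
    fun n t ht => (hz n t (Ico_subset_Icc_self ht)).mono_of_mem_nhdsWithin
      (mem_of_superset (Icc_mem_nhdsGE ht.2) (Icc_subset_Icc_left ht.1))
  have huniq : ∀ n k : ℕ, n ≤ k → EqOn (z n) (z k) (Icc 0 n) := by
    intro n k hnk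
    have hnk' : (n : ℝ) ≤ k := by exact_mod_cast hnk
    exact ODE_solution_unique_of_mem_Icc_right (v := fun _ => F) (s := fun _ => univ)
      (fun _ _ => hK.lipschitzOnWith) (hcont n) (hright n) (fun _ _ => mem_univ _)
      ((hcont k).mono (Icc_subset_Icc_right hnk'))
      (fun t ht => hright k t (Ico_subset_Ico_right hnk' ht)) (fun _ _ => mem_univ _)
      (by rw [hz0, hz0])
  have heq : ∀ n : ℕ, ∀ t ∈ Icc (0 : ℝ) n, z (⌈t⌉₊) t = z n t := fun n t ht =>
    huniq _ n (Nat.ceil_le.2 ht.2) ⟨ht.1, Nat.le_ceil t⟩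
  refine ⟨fun t => z ⌈t⌉₊ t, by simp [hz0], fun t ht => ?_⟩
  obtain ⟨n, hn⟩ := exists_nat_gt t
  have h1 := hz n t ⟨ht, hn.le⟩
  have h2 : HasDerivWithinAt (fun t => z ⌈t⌉₊ t) (F (z n t)) (Icc (0 : ℝ) n) t :=
    h1.congr (fun τ hτ => heq n τ hτ) (heq n t ⟨ht, hn.le⟩)
  simp only [heq n t ⟨ht, hn.le⟩]
  refine h2.mono_of_mem_nhdsWithin ?_
  filter_upwards [self_mem_nhdsWithin, mem_nhdsWithin_of_mem_nhds (Iic_mem_nhds hn)] with τ h h'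
  exact ⟨h, h'⟩

/-- A `C¹` vector field has global forward solutions from an initial point all of whose finite-time
solutions obey a common bound. -/
theorem exists_solution_of_a_priori_bound [FiniteDimensional ℝ E] {F : E → E}
    (hF : ContDiff ℝ 1 F) (z₀ : E) (P : ℝ)
    (hP : ∀ T, 0 ≤ T → ∀ z : ℝ → E, z 0 = z₀ → ContinuousOn z (Icc 0 T) →
      (∀ t ∈ Ico 0 T, HasDerivWithinAt z (F (z t)) (Ici t) t) → ‖z T‖ < P) :
    ∃ z : ℝ → E, z 0 = z₀ ∧ ∀ t, 0 ≤ t → HasDerivWithinAt z (F (z t)) (Ici 0) t := by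
  have : CompleteSpace E := FiniteDimensional.complete ℝ E
  have h0 : ‖z₀‖ < P := hP 0 le_rfl (fun _ => z₀) rfl continuousOn_const (by simp)
  have hP0 : 0 < P := (norm_nonneg _).trans_lt h0
  -- The cut-off field is `C¹` with compact support, hence Lipschitz and bounded, and agrees with
  -- `F` on the ball of radius `P`. While its solution is in that ball it solves the original
  -- equation, so the a priori bound keeps it strictly inside.
  let b : ContDiffBump (0 : E) := ⟨P, P + 1, hP0, by linarith⟩
  have hb : ∀ z, ‖z‖ ≤ P → b z • F z = F z := fun z hz => by
    rw [b.one_of_mem_closedBall (by simpa [b] using hz), one_smul]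
  have hG : ContDiff ℝ 1 fun z => b z • F z := b.contDiff.smul hF
  have hsupp : HasCompactSupport fun z => b z • F z := b.hasCompactSupport.smul_right
  obtain ⟨K, hK⟩ := hG.lipschitzWith_of_hasCompactSupport hsupp one_ne_zero
  obtain ⟨L, hL⟩ := hsupp.exists_bound_of_continuous hG.continuous
  obtain ⟨z, hz0, hz⟩ := exists_solution_of_lipschitzWith_of_bounded hK hL z₀
  have hzc : ContinuousOn z (Ici 0) := fun t ht => (hz t ht).continuousWithinAt
  have hbound : ∀ T, 0 ≤ T → ‖z T‖ < P := by
    intro T hT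
    refine lt_of_forall_Icc_le_imp_lt (N := fun t => ‖z t‖)
      (hzc.mono Icc_subset_Ici_self).norm ?_ (by simpa [hz0] using h0.le) T ⟨hT, le_rfl⟩
    intro t ht hle
    refine hP t ht.1 z hz0 (hzc.mono Icc_subset_Ici_self) fun τ hτ => ?_
    have := (hz τ hτ.1).mono (Ici_subset_Ici.2 hτ.1)
    rwa [hb _ (hle τ (Ico_subset_Icc_self hτ))] at this
  refine ⟨z, hz0, fun t ht => ?_⟩
  have := hz t ht
  rwa [hb _ (hbound t ht).le] at this

end GlobalSolutions

/-! ### Growth of strictly monotone vector fields -/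

/-- Along each ray from `p` the radial component of `G` is strictly increasing and starts at zero.
Its minimum `q r` over the compact unit sphere keeps these properties and is continuous in `r`; then
`α r = r * q r`. -/
theorem exists_isClassK_le_inner {E : Type*} [NormedAddCommGroup E] [InnerProductSpace ℝ E]
    [FiniteDimensional ℝ E] [Nontrivial E] {G : E → E} (hG : Continuous G)
    (hmono : ∀ x y, x ≠ y → 0 < inner ℝ (x - y) (G x - G y)) {p : E} (hp : G p = 0) :
    ∃ α : ℝ → ℝ, IsClassK α ∧ ∀ x, α ‖x - p‖ ≤ inner ℝ (x - p) (G x) := by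
  set S : Set E := Metric.sphere 0 1
  have hS : IsCompact S := isCompact_sphere 0 1
  have hSne : S.Nonempty := NormedSpace.sphere_nonempty.2 zero_le_one
  set h : ℝ → E → ℝ := fun r e => inner ℝ e (G (p + r • e)) with hh
  have hhc : Continuous ↿h := by
    change Continuous fun q : ℝ × E => inner ℝ q.2 (G (p + q.1 • q.2))
    fun_prop
  have hhc' : ∀ r, Continuous (h r) := fun r => by
    simp only [hh]; fun_prop
  set q : ℝ → ℝ := fun r => sInf (h r '' S) with hq
  have hqc : Continuous q := hS.continuous_sInf hhc
  have hqle : ∀ r, ∀ e ∈ S, q r ≤ h r e := fun r e he =>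
    csInf_le (hS.image (hhc' r)).bddBelow (mem_image_of_mem _ he)
  have hlt : ∀ r r', r < r' → ∀ e ∈ S, h r e < h r' e := by
    intro r r' hrr e he
    have he1 : ‖e‖ = 1 := by simpa [S] using he
    have hsub : (p + r' • e) - (p + r • e) = (r' - r) • e := by
      rw [add_sub_add_left_eq_sub, sub_smul]
    have hne : p + r' • e ≠ p + r • e := by
      rw [Ne, ← sub_eq_zero, hsub, smul_eq_zero, not_or]
      exact ⟨(sub_pos.2 hrr).ne', norm_pos_iff.1 (by rw [he1]; exact one_pos)⟩
    have := hmono _ _ hne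
    rw [hsub, inner_smul_left, inner_sub_right] at this
    have := pos_of_mul_pos_right this (by simpa using hrr.le)
    simp only [hh]
    linarith
  have hqmono : StrictMono q := by
    intro r r' hrr
    obtain ⟨e, he, heq⟩ := hS.exists_sInf_image_eq hSne (hhc' r').continuousOn
    calc q r ≤ h r e := hqle r e he
      _ < h r' e := hlt r r' hrr e he
      _ = q r' := heq.symm
  have hq0 : q 0 = 0 := by
    obtain ⟨e, he, heq⟩ := hS.exists_sInf_image_eq hSne (hhc' 0).continuousOn
    exact heq.trans (by simp [hh, hp])
  refine ⟨fun r => r * q r, ⟨by fun_prop, ?_, by simp⟩, fun x => ?_⟩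
  · intro r hr r' hr' hrr
    have hr0 : (0 : ℝ) ≤ r := hr
    have h1 : 0 ≤ q r := hq0 ▸ hqmono.monotone hr0
    exact mul_lt_mul'' hrr (hqmono hrr) hr0 h1
  · rcases eq_or_ne x p with rfl | hx
    · simp
    · have hr : 0 < ‖x - p‖ := norm_pos_iff.2 (sub_ne_zero.2 hx)
      have he : ‖x - p‖⁻¹ • (x - p) ∈ S := by
        simp [S, norm_smul, hr.ne']
      have h1 := mul_le_mul_of_nonneg_left (hqle ‖x - p‖ _ he) hr.le
      refine h1.trans_eq ?_
      simp only [hh]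
      rw [smul_smul, mul_inv_cancel₀ hr.ne', one_smul, add_sub_cancel, inner_smul_left]
      simp [hr.ne']

/-- Turns a decay rate in the distance into one in a potential at most `c` times the squared
distance. The factor `1/2` leaves a second copy of the rate for absorbing errors. -/
theorem IsClassK.half_comp_sqrt_div {α : ℝ → ℝ} (hα : IsClassK α) {c : ℝ} (hc : 0 < c) :
    IsClassK fun u => α √(u / c) / 2 := by
  refine ⟨?_, ?_, by simp [hα.map_zero]⟩
  · exact (hα.continuousOn.comp (f := fun u => √(u / c)) (by fun_prop)
      fun u _ => Real.sqrt_nonneg _).div_const 2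
  · intro u hu u' hu' huu
    have hu0 : (0 : ℝ) ≤ u := hu
    have h1 : √(u / c) < √(u' / c) :=
      Real.sqrt_lt_sqrt (by positivity) (div_lt_div_of_pos_right huu hc)
    have := hα.strictMonoOn (mem_Ici.2 (Real.sqrt_nonneg _)) (mem_Ici.2 (Real.sqrt_nonneg _)) h1
    simp only
    linarith

/-! ### Poincaré inequality for connected weighted graphs -/

namespace WeightedGraph

variable {V : Type} [Fintype V] {A : WeightedGraph V}

theorem IsUndirected.two_mul_sum_mul_sum (hA : A.IsUndirected) (ξ : V → ℝ) :
    2 * ∑ i, ξ i * ∑ j, A.weight i j * (ξ i - ξ j) =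
      ∑ i, ∑ j, A.weight i j * (ξ i - ξ j) ^ 2 := by
  have h1 : ∑ i, ξ i * ∑ j, A.weight i j * (ξ i - ξ j) =
      ∑ i, ∑ j, A.weight i j * ξ i * (ξ i - ξ j) := by
    refine Finset.sum_congr rfl fun i _ => ?_
    rw [Finset.mul_sum]
    exact Finset.sum_congr rfl fun j _ => by ring
  have h2 : ∑ i, ∑ j, A.weight i j * ξ i * (ξ i - ξ j) =
      ∑ i, ∑ j, A.weight i j * ξ j * (ξ j - ξ i) := by
    rw [Finset.sum_comm]
    exact Finset.sum_congr rfl fun i _ => Finset.sum_congr rfl fun j _ => by rw [hA j i]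
  rw [two_mul, h1]
  nth_rewrite 2 [h2]
  simp only [← Finset.sum_add_distrib]
  exact Finset.sum_congr rfl fun i _ => Finset.sum_congr rfl fun j _ => by ring

/-- After symmetrization the form is a sum of nonnegative terms, so `ξ` agrees across every edge and
then along paths. -/
theorem IsUndirected.eq_of_form_eq_zero (hA : A.IsUndirected) (hc : A.IsConnected) {ξ : V → ℝ}
    (hξ : ∑ i, ξ i * ∑ j, A.weight i j * (ξ i - ξ j) = 0) (i j : V) : ξ i = ξ j := by
  have h0 := hA.two_mul_sum_mul_sum ξ
  rw [hξ, mul_zero] at h0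
  have hnn : ∀ i j, 0 ≤ A.weight i j * (ξ i - ξ j) ^ 2 := fun i j =>
    mul_nonneg (A.nonneg i j) (sq_nonneg _)
  have h1 : ∀ i j, A.weight i j * (ξ i - ξ j) ^ 2 = 0 := by
    intro i j
    have h2 := (Finset.sum_eq_zero_iff_of_nonneg
      (fun i _ => Finset.sum_nonneg fun j _ => hnn i j)).1 h0.symm i (Finset.mem_univ i)
    exact (Finset.sum_eq_zero_iff_of_nonneg (fun j _ => hnn i j)).1 h2 j (Finset.mem_univ j)
  induction hc i j with
  | refl => rfl
  | tail _ h ih =>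
    rw [ih]
    have := h1 _ _ |> (mul_eq_zero.1 ·) |>.resolve_left h.ne'
    exact (sub_eq_zero.1 (pow_eq_zero_iff two_ne_zero |>.1 this)).symm

/-- The constant is the minimum of the quadratic form over unit vectors of zero sum. It is positive,
since a null vector is constant and a constant vector of zero sum vanishes. -/
theorem IsUndirected.exists_poincare (hA : A.IsUndirected) (hc : A.IsConnected) :
    ∃ c : ℝ, 0 < c ∧ ∀ ξ : V → ℝ, ∑ i, ξ i = 0 →
      c * ∑ i, ξ i ^ 2 ≤ ∑ i, ξ i * ∑ j, A.weight i j * (ξ i - ξ j) := by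
  set Q : EuclideanSpace ℝ V → ℝ := fun ξ => ∑ i, ξ i * ∑ j, A.weight i j * (ξ i - ξ j) with hQ
  have hQc : Continuous Q := by fun_prop
  set S : Set (EuclideanSpace ℝ V) := Metric.sphere 0 1 ∩ {ξ | ∑ i, ξ i = 0}
  have hS : IsCompact S := (isCompact_sphere 0 1).inter_right
    (isClosed_eq (by fun_prop) continuous_const)
  have hhom : ∀ (r : ℝ) (ξ : EuclideanSpace ℝ V), Q (r • ξ) = r ^ 2 * Q ξ := by
    intro r ξ
    simp only [hQ, PiLp.smul_apply, smul_eq_mul, Finset.mul_sum]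
    exact Finset.sum_congr rfl fun i _ => Finset.sum_congr rfl fun j _ => by ring
  have hnorm : ∀ ξ : V → ℝ, ∑ i, ξ i ^ 2 = ‖WithLp.toLp 2 ξ‖ ^ 2 := fun ξ => by
    simp [EuclideanSpace.norm_sq_eq]
  have hunit : ∀ ξ : V → ℝ, ∑ i, ξ i = 0 → ξ ≠ 0 →
      ‖WithLp.toLp 2 ξ‖⁻¹ • WithLp.toLp 2 ξ ∈ S := by
    intro ξ hs hne
    have : ‖WithLp.toLp 2 ξ‖ ≠ 0 := by simpa using hne
    refine ⟨by simp [norm_smul, this], ?_⟩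
    simp [← Finset.mul_sum, hs]
  -- The set is empty when there is at most one node, as can happen for a neighborhood; then any
  -- constant works.
  rcases S.eq_empty_or_nonempty with hemp | hne
  · refine ⟨1, one_pos, fun ξ hξ => ?_⟩
    have : ξ = 0 := by
      by_contra h
      have := hunit ξ hξ h
      simp [hemp] at this
    simp [this]
  · obtain ⟨e, he, hmin⟩ := hS.exists_isMinOn hne hQc.continuousOn
    have he1 : ‖e‖ = 1 := by simpa using he.1
    have hQe0 : 0 ≤ Q e := by
      have := hA.two_mul_sum_mul_sum (fun i => e i)
      have h2 : 0 ≤ ∑ i, ∑ j, A.weight i j * (e i - e j) ^ 2 := Finset.sum_nonneg fun i _ =>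
        Finset.sum_nonneg fun j _ => mul_nonneg (A.nonneg i j) (sq_nonneg _)
      simp only [hQ]
      linarith
    have hQe : 0 < Q e := by
      refine hQe0.lt_of_ne fun h => ?_
      have hall := hA.eq_of_form_eq_zero hc (ξ := fun i => e i) h.symm
      have hsum : ∑ i, e i = 0 := he.2
      have hz : e = 0 := by
        ext i
        have h3 : ∑ j, e j = ∑ _j : V, e i := Finset.sum_congr rfl fun j _ => hall j i
        rw [hsum, Finset.sum_const, nsmul_eq_mul] at h3
        have hcard : ((Finset.univ : Finset V).card : ℝ) ≠ 0 := by
          exact_mod_cast (Finset.card_pos.2 ⟨i, Finset.mem_univ i⟩).ne'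
        exact (mul_eq_zero.1 h3.symm).resolve_left hcard
      simp [hz] at he1
    refine ⟨Q e, hQe, fun ξ hξ => ?_⟩
    rcases eq_or_ne ξ 0 with rfl | hne'
    · simp
    · have h1 : Q e ≤ Q _ := hmin (hunit ξ hξ hne')
      have h2 : (0 : ℝ) < ‖WithLp.toLp 2 ξ‖ ^ 2 := by
        have : ‖WithLp.toLp 2 ξ‖ ≠ 0 := by simpa using hne'
        positivity
      rw [hhom, inv_pow, inv_mul_eq_div, le_div_iff₀ h2] at h1
      rw [hnorm]
      exact h1

end WeightedGraph

/-! ### The game -/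

variable {m : ℕ} {f : Fin m → EuclideanSpace ℝ (Fin m) → ℝ}

theorem mem_closedNbhd {j k : Fin m} :
    j ∈ closedNbhd f k ↔ (interferenceGraph f).Adj k j ∨ j = k := by
  simp [closedNbhd]

theorem mem_closedNbhd_comm {j k : Fin m} : j ∈ closedNbhd f k ↔ k ∈ closedNbhd f j := by
  rw [mem_closedNbhd, mem_closedNbhd, SimpleGraph.adj_comm, eq_comm]

theorem self_mem_closedNbhd (k : Fin m) : k ∈ closedNbhd f k := mem_closedNbhd.2 (Or.inr rfl)

theorem card_closedNbhd_pos (k : Fin m) : (0 : ℝ) < (closedNbhd f k).card := by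
  exact_mod_cast Finset.card_pos.2 ⟨k, self_mem_closedNbhd k⟩

theorem card_closedNbhd_le (k : Fin m) : ((closedNbhd f k).card : ℝ) ≤ m := by
  exact_mod_cast (Finset.card_le_univ _).trans_eq (Fintype.card_fin m)

theorem partialDeriv_eq_zero {h : EuclideanSpace ℝ (Fin m) → ℝ} (hd : Differentiable ℝ h)
    {k : Fin m} (hk : ¬ ExplicitlyDependsOn h k) (x : EuclideanSpace ℝ (Fin m)) :
    partialDeriv h k x = 0 := by
  have h1 : HasDerivAt (fun s : ℝ => x + s • EuclideanSpace.single k (1 : ℝ))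
      (EuclideanSpace.single k 1) 0 := by
    simpa using ((hasDerivAt_id (0 : ℝ)).smul_const (EuclideanSpace.single k (1 : ℝ))).const_add x
  have h2 : HasFDerivAt h (fderiv ℝ h x) (x + (0 : ℝ) • EuclideanSpace.single k (1 : ℝ)) := by
    simpa using (hd x).hasFDerivAt
  have h3 := h2.comp_hasDerivAt 0 h1
  have h4 : (h ∘ fun s : ℝ => x + s • EuclideanSpace.single k (1 : ℝ)) = fun _ => h x := by
    funext s
    by_contra hne
    refine hk ⟨_, x, fun i hi => ?_, hne⟩
    simp [hi]
  rw [h4] at h3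
  exact h3.unique (hasDerivAt_const 0 (h x))

theorem contDiff_partialDeriv {h : EuclideanSpace ℝ (Fin m) → ℝ} (hh : ContDiff ℝ 2 h)
    (k : Fin m) : ContDiff ℝ 1 (partialDeriv h k) :=
  (hh.fderiv_right (m := 1) (by norm_num)).clm_apply contDiff_const

/-- A cost depending on `x_k` belongs to `k` or to a neighbor of `k`, so the other agents contribute
nothing. -/
theorem pseudoGradient_apply (hf : ∀ j, Differentiable ℝ (f j)) (x : EuclideanSpace ℝ (Fin m))
    (k : Fin m) :
    pseudoGradient f x k = ∑ j ∈ closedNbhd f k, partialDeriv (f j) k x := by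
  have h1 : fderiv ℝ (socialCost f) x = ∑ j, fderiv ℝ (f j) x := by
    have : socialCost f = fun x => ∑ j, f j x := rfl
    rw [this, fderiv_fun_sum fun j _ => hf j x]
  have h2 : pseudoGradient f x k = ∑ j, partialDeriv (f j) k x := by
    simp [pseudoGradient, partialDeriv, h1]
  rw [h2]
  refine (Finset.sum_subset (Finset.subset_univ _) fun j _ hj => ?_).symm
  refine partialDeriv_eq_zero (hf j) (fun hdep => hj ?_) x
  by_cases hjk : j = k
  · exact mem_closedNbhd.2 (Or.inr hjk)
  · exact mem_closedNbhd.2 (Or.inl ⟨Ne.symm hjk, Or.inr hdep⟩)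

theorem continuous_pseudoGradient (hf : ∀ j, ContDiff ℝ 2 (f j)) :
    Continuous (pseudoGradient f) := by
  refine (PiLp.continuous_toLp 2 _).comp (continuous_pi fun k => ?_)
  have : ContDiff ℝ 2 (socialCost f) := ContDiff.sum fun j _ => hf j
  exact (contDiff_partialDeriv this k).continuous

theorem pseudoGradient_eq_zero {x : EuclideanSpace ℝ (Fin m)}
    (hx : IsMinOn (socialCost f) univ x) : pseudoGradient f x = 0 := by
  ext k
  have : fderiv ℝ (socialCost f) x = 0 :=
    IsLocalMin.fderiv_eq_zero (hx.isLocalMin univ_mem)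
  simp [pseudoGradient, partialDeriv, this]

theorem exists_poincare_closedNbhd {A : WeightedGraph (Fin m)}
    (hundirected : ∀ k, (commGraphTo f A k).IsUndirected)
    (hconnected : ∀ k, (commGraphTo f A k).IsConnected) :
    ∃ c : ℝ, 0 < c ∧ ∀ (k : Fin m) (ξ : Fin m → ℝ), ∑ j ∈ closedNbhd f k, ξ j = 0 →
      c * ∑ j ∈ closedNbhd f k, ξ j ^ 2 ≤
        ∑ j ∈ closedNbhd f k, ξ j * ∑ l ∈ closedNbhd f k, A.weight j l * (ξ j - ξ l) := by
  choose c hc hcξ using fun k => (hundirected k).exists_poincare (hconnected k)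
  obtain ⟨c₀, hc₀, hle⟩ : ∃ c₀ : ℝ, 0 < c₀ ∧ ∀ k, c₀ ≤ c k := by
    rcases isEmpty_or_nonempty (Fin m) with h | h
    · exact ⟨1, one_pos, fun k => h.elim k⟩
    · obtain ⟨k, hk⟩ := Finite.exists_min c
      exact ⟨c k, hc k, hk⟩
  refine ⟨c₀, hc₀, fun k ξ hξ => ?_⟩
  have h1 := hcξ k (fun j => ξ j) (by rwa [Finset.sum_coe_sort (closedNbhd f k) ξ])
  rw [Finset.sum_coe_sort (closedNbhd f k) (fun j => ξ j ^ 2)] at h1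
  have h2 : ∀ j : closedNbhd f k,
      ∑ l : closedNbhd f k, (commGraphTo f A k).weight j l * (ξ j - ξ l) =
        ∑ l ∈ closedNbhd f k, A.weight j l * (ξ j - ξ l) := fun j =>
    Finset.sum_coe_sort (closedNbhd f k) (fun l => A.weight j l * (ξ j - ξ l))
  simp only [h2] at h1
  rw [Finset.sum_coe_sort (closedNbhd f k)
    (fun j => ξ j * ∑ l ∈ closedNbhd f k, A.weight j l * (ξ j - ξ l))] at h1
  exact (mul_le_mul_of_nonneg_right (hle k) (Finset.sum_nonneg fun _ _ => sq_nonneg _)).trans h1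

/-! ### Averages, deviations and the norm of `χ` -/

/-- The average over the closed interference neighborhood of `k` of the estimates `g_{jk}`. -/
noncomputable def gMean (f : Fin m → EuclideanSpace ℝ (Fin m) → ℝ)
    (x : EuclideanSpace ℝ (Fin m)) (w : Fin m → Fin m → ℝ) (k : Fin m) : ℝ :=
  (∑ j ∈ closedNbhd f k, gEst f x w j k) / (closedNbhd f k).card

/-- The deviation of the estimate `g_{jk}` from the average over the closed interference
neighborhood of `k`. -/
noncomputable def gDev (f : Fin m → EuclideanSpace ℝ (Fin m) → ℝ)
    (x : EuclideanSpace ℝ (Fin m)) (w : Fin m → Fin m → ℝ) (j k : Fin m) : ℝ :=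
  gEst f x w j k - gMean f x w k

/-- The total squared deviation of the estimates from their averages. -/
noncomputable def disagreement (f : Fin m → EuclideanSpace ℝ (Fin m) → ℝ)
    (x : EuclideanSpace ℝ (Fin m)) (w : Fin m → Fin m → ℝ) : ℝ :=
  ∑ k, ∑ j ∈ closedNbhd f k, gDev f x w j k ^ 2

theorem disagreement_nonneg (x : EuclideanSpace ℝ (Fin m)) (w : Fin m → Fin m → ℝ) :
    0 ≤ disagreement f x w :=
  Finset.sum_nonneg fun _ _ => Finset.sum_nonneg fun _ _ => sq_nonneg _

theorem sum_gDev (x : EuclideanSpace ℝ (Fin m)) (w : Fin m → Fin m → ℝ) (k : Fin m) :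
    ∑ j ∈ closedNbhd f k, gDev f x w j k = 0 := by
  simp only [gDev, Finset.sum_sub_distrib, Finset.sum_const, nsmul_eq_mul, gMean]
  field_simp [(card_closedNbhd_pos (f := f) k).ne']
  simp

theorem abs_gDev_le_sqrt_disagreement (x : EuclideanSpace ℝ (Fin m)) (w : Fin m → Fin m → ℝ)
    {j k : Fin m} (hj : j ∈ closedNbhd f k) : |gDev f x w j k| ≤ √(disagreement f x w) := by
  refine Real.abs_le_sqrt ?_
  have h1 : gDev f x w j k ^ 2 ≤ ∑ j ∈ closedNbhd f k, gDev f x w j k ^ 2 :=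
    Finset.single_le_sum (f := fun j => gDev f x w j k ^ 2) (fun _ _ => sq_nonneg _) hj
  exact h1.trans (Finset.single_le_sum (f := fun k => ∑ j ∈ closedNbhd f k, gDev f x w j k ^ 2)
    (fun _ _ => Finset.sum_nonneg fun _ _ => sq_nonneg _) (Finset.mem_univ k))

/-- The orthogonal matrix preserves the norm of `g`; dropping its first coordinate removes `(∑ g)² /
n`, exactly what subtracting the mean removes. -/
theorem IsOrthogonalCompletion.sum_sq_mulVec {V : Type} [Fintype V] [DecidableEq V] [Nonempty V]
    {n : ℕ} {R : Matrix V (Fin n) ℝ} (hR : IsOrthogonalCompletion R) (g : V → ℝ) :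
    ∑ i, (R.transpose.mulVec g) i ^ 2 = ∑ j, (g j - (∑ l, g l) / Fintype.card V) ^ 2 := by
  have hcard : (Fintype.card V : ℝ) ≠ 0 := by exact_mod_cast Fintype.card_ne_zero
  have h1 : ∑ i, ((augment R).transpose.mulVec g) i ^ 2 = ∑ j, g j ^ 2 := by
    have e1 : ∑ i, ((augment R).transpose.mulVec g) i ^ 2 =
        (augment R).transpose.mulVec g ⬝ᵥ (augment R).transpose.mulVec g := by
      simp [dotProduct, sq]
    rw [e1, Matrix.dotProduct_mulVec, Matrix.vecMul_transpose, Matrix.mulVec_mulVec, hR.2,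
      Matrix.one_mulVec]
    simp [dotProduct, sq]
  have h2 : ∀ i, ((augment R).transpose.mulVec g) (Sum.inr i) = (R.transpose.mulVec g) i :=
    fun i => rfl
  have h3 : ((augment R).transpose.mulVec g) (Sum.inl ()) ^ 2 =
      (∑ l, g l) ^ 2 / Fintype.card V := by
    have e1 : ((augment R).transpose.mulVec g) (Sum.inl ()) =
        ∑ l, 1 / √(Fintype.card V : ℝ) * g l := rfl
    rw [e1, ← Finset.mul_sum, mul_pow, div_pow, Real.sq_sqrt (Nat.cast_nonneg _)]
    ring
  rw [Fintype.sum_sum_type] at h1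
  simp only [h2, Finset.univ_unique, PUnit.default_eq_unit, Finset.sum_singleton, h3] at h1
  have h4 : ∑ j, (g j - (∑ l, g l) / Fintype.card V) ^ 2 =
      ∑ j, g j ^ 2 - (∑ l, g l) ^ 2 / Fintype.card V := by
    simp only [sub_sq, Finset.sum_add_distrib, Finset.sum_sub_distrib, ← Finset.sum_mul,
      ← Finset.mul_sum, Finset.sum_const, nsmul_eq_mul, Finset.card_univ]
    field_simp
    ring
  rw [h4]
  linarith

theorem norm_chi_sq {R : ∀ k, Matrix (closedNbhd f k) (Fin ((closedNbhd f k).card - 1)) ℝ}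
    (hR : ∀ k, IsOrthogonalCompletion (R k)) (xstar x : EuclideanSpace ℝ (Fin m))
    (w : Fin m → Fin m → ℝ) :
    ‖chi f R xstar x w‖ ^ 2 = disagreement f x w + ‖x - xstar‖ ^ 2 := by
  rw [EuclideanSpace.norm_sq_eq, EuclideanSpace.norm_sq_eq, Fintype.sum_sum_type]
  congr 1
  · simp only [chi, Sum.elim_inl, Real.norm_eq_abs, sq_abs]
    rw [Fintype.sum_sigma]
    refine Finset.sum_congr rfl fun k _ => ?_
    have : Nonempty (closedNbhd f k) := ⟨⟨k, self_mem_closedNbhd k⟩⟩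
    simp only [gBar]
    rw [(hR k).sum_sq_mulVec]
    rw [Finset.sum_coe_sort (closedNbhd f k) (fun j => gEst f x w j k), Fintype.card_coe]
    exact Finset.sum_coe_sort (closedNbhd f k) (fun j => gDev f x w j k ^ 2)

/-! ### Trajectories and the conserved sums -/

/-- The velocity of the actions. -/
noncomputable def actionVelocity (f : Fin m → EuclideanSpace ℝ (Fin m) → ℝ) (dbar : Fin m → ℝ)
    (δ : ℝ) (x : EuclideanSpace ℝ (Fin m)) (w : Fin m → Fin m → ℝ) : EuclideanSpace ℝ (Fin m) :=
  WithLp.toLp 2 fun j => -(δ * dbar j) * gEst f x w j j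

/-- The velocity of the auxiliary variable `w_{jk}`. -/
noncomputable def auxVelocity (f : Fin m → EuclideanSpace ℝ (Fin m) → ℝ)
    (A : WeightedGraph (Fin m)) (x : EuclideanSpace ℝ (Fin m)) (w : Fin m → Fin m → ℝ)
    (j k : Fin m) : ℝ :=
  -∑ l ∈ closedNbhd f k, A.weight j l * (gEst f x w j k - gEst f x w l k)

/-- `(x, w)` is a trajectory of the seeking strategy on `[0, T]`. -/
structure IsTrajectoryOn (f : Fin m → EuclideanSpace ℝ (Fin m) → ℝ)
    (A : WeightedGraph (Fin m)) (dbar : Fin m → ℝ) (δ T : ℝ)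
    (x : ℝ → EuclideanSpace ℝ (Fin m)) (w : ℝ → Fin m → Fin m → ℝ) : Prop where
  continuousOn_action : ContinuousOn x (Icc 0 T)
  continuousOn_aux : ∀ k, ∀ j ∈ closedNbhd f k, ContinuousOn (fun t => w t j k) (Icc 0 T)
  action : ∀ t ∈ Ico 0 T, HasDerivWithinAt x (actionVelocity f dbar δ (x t) (w t)) (Ici t) t
  aux : ∀ t ∈ Ico 0 T, ∀ k, ∀ j ∈ closedNbhd f k,
    HasDerivWithinAt (fun s => w s j k) (auxVelocity f A (x t) (w t) j k) (Ici t) t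
  aux_zero : ∀ k, ∀ j ∈ closedNbhd f k, w 0 j k = 0

theorem IsTrajectoryOn.mono {A : WeightedGraph (Fin m)} {dbar : Fin m → ℝ} {δ T T' : ℝ}
    {x : ℝ → EuclideanSpace ℝ (Fin m)} {w : ℝ → Fin m → Fin m → ℝ}
    (h : IsTrajectoryOn f A dbar δ T x w) (hT : T' ≤ T) : IsTrajectoryOn f A dbar δ T' x w :=
  ⟨h.continuousOn_action.mono (Icc_subset_Icc_right hT),
    fun k j hj => (h.continuousOn_aux k j hj).mono (Icc_subset_Icc_right hT),
    fun t ht => h.action t (Ico_subset_Ico_right hT ht),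
    fun t ht => h.aux t (Ico_subset_Ico_right hT ht), h.aux_zero⟩

theorem hasDerivWithinAt_euclidean {y : ℝ → EuclideanSpace ℝ (Fin m)}
    {y' : Fin m → ℝ} {s : Set ℝ} {t : ℝ} :
    HasDerivWithinAt y (WithLp.toLp 2 y') s t ↔
      ∀ j, HasDerivWithinAt (fun τ => y τ j) (y' j) s t := by
  constructor
  · intro h j
    exact (EuclideanSpace.proj j : EuclideanSpace ℝ (Fin m) →L[ℝ] ℝ).hasFDerivAt
      |>.comp_hasDerivWithinAt t h
  · intro h
    exact (PiLp.continuousLinearEquiv 2 ℝ (fun _ : Fin m => ℝ)).symm.hasFDerivAt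
      |>.comp_hasDerivWithinAt t (hasDerivWithinAt_pi.2 h)

theorem IsTrajectory.isTrajectoryOn {A : WeightedGraph (Fin m)} {dbar : Fin m → ℝ} {δ : ℝ}
    {x : ℝ → EuclideanSpace ℝ (Fin m)} {w : ℝ → Fin m → Fin m → ℝ}
    (h : IsTrajectory f A dbar δ x w) (T : ℝ) : IsTrajectoryOn f A dbar δ T x w := by
  have hx : ∀ t, 0 ≤ t → HasDerivWithinAt x (actionVelocity f dbar δ (x t) (w t)) (Ici 0) t :=
    fun t ht => hasDerivWithinAt_euclidean.2 (h.action t ht)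
  refine ⟨fun t ht => (hx t ht.1).continuousWithinAt.mono Icc_subset_Ici_self,
    fun k j hj t ht => ?_, fun t ht => (hx t ht.1).mono (Ici_subset_Ici.2 ht.1),
    fun t ht k j hj => ?_, fun k j hj => h.auxiliary_zero j k (mem_closedNbhd_comm.1 hj)⟩
  · exact (h.auxiliary t ht.1 j k (mem_closedNbhd_comm.1 hj)).continuousWithinAt.mono
      Icc_subset_Ici_self
  · exact (h.auxiliary t ht.1 j k (mem_closedNbhd_comm.1 hj)).mono (Ici_subset_Ici.2 ht.1)

/-- With symmetric weights the summand is antisymmetric in `j` and `l`, so the double sum equals its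
own negative. -/
theorem sum_auxVelocity {A : WeightedGraph (Fin m)}
    (hundirected : ∀ k, (commGraphTo f A k).IsUndirected) (x : EuclideanSpace ℝ (Fin m))
    (w : Fin m → Fin m → ℝ) (k : Fin m) :
    ∑ j ∈ closedNbhd f k, auxVelocity f A x w j k = 0 := by
  have h1 : ∑ j ∈ closedNbhd f k, auxVelocity f A x w j k =
      -∑ j ∈ closedNbhd f k, auxVelocity f A x w j k := by
    simp only [auxVelocity, Finset.sum_neg_distrib, neg_neg]
    conv_rhs => rw [Finset.sum_comm]
    rw [← Finset.sum_neg_distrib]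
    refine Finset.sum_congr rfl fun j hj => ?_
    rw [← Finset.sum_neg_distrib]
    refine Finset.sum_congr rfl fun l hl => ?_
    have : A.weight j l = A.weight l j := hundirected k ⟨j, hj⟩ ⟨l, hl⟩
    rw [this]
    ring
  linarith

namespace IsTrajectoryOn

variable {A : WeightedGraph (Fin m)} {dbar : Fin m → ℝ} {δ T : ℝ}
  {x : ℝ → EuclideanSpace ℝ (Fin m)} {w : ℝ → Fin m → Fin m → ℝ}

theorem sum_aux (h : IsTrajectoryOn f A dbar δ T x w)
    (hundirected : ∀ k, (commGraphTo f A k).IsUndirected) (k : Fin m) :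
    ∀ t ∈ Icc 0 T, ∑ j ∈ closedNbhd f k, w t j k = 0 := by
  intro t ht
  have h0 : ∑ j ∈ closedNbhd f k, w 0 j k = 0 := Finset.sum_eq_zero (h.aux_zero k)
  rw [← h0]
  refine constant_of_has_deriv_right_zero (f := fun t => ∑ j ∈ closedNbhd f k, w t j k)
    (continuousOn_finsetSum _ (h.continuousOn_aux k)) (fun τ hτ => ?_) t ht
  rw [← sum_auxVelocity hundirected (x τ) (w τ) k]
  exact HasDerivWithinAt.fun_sum (h.aux τ hτ k)

theorem gMean_eq (h : IsTrajectoryOn f A dbar δ T x w) (hf : ∀ j, Differentiable ℝ (f j))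
    (hundirected : ∀ k, (commGraphTo f A k).IsUndirected) (k : Fin m) {t : ℝ}
    (ht : t ∈ Icc 0 T) :
    gMean f (x t) (w t) k = pseudoGradient f (x t) k / (closedNbhd f k).card := by
  simp only [gMean, gEst, Finset.sum_add_distrib, h.sum_aux hundirected k t ht, zero_add,
    pseudoGradient_apply hf]

theorem gEst_eq (h : IsTrajectoryOn f A dbar δ T x w) (hf : ∀ j, Differentiable ℝ (f j))
    (hundirected : ∀ k, (commGraphTo f A k).IsUndirected) (j k : Fin m) {t : ℝ}
    (ht : t ∈ Icc 0 T) :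
    gEst f (x t) (w t) j k =
      gDev f (x t) (w t) j k + pseudoGradient f (x t) k / (closedNbhd f k).card := by
  rw [← h.gMean_eq hf hundirected k ht, gDev, sub_add_cancel]

theorem continuousOn_gEst (h : IsTrajectoryOn f A dbar δ T x w) (hf : ∀ j, ContDiff ℝ 2 (f j))
    (k : Fin m) {j : Fin m} (hj : j ∈ closedNbhd f k) :
    ContinuousOn (fun t => gEst f (x t) (w t) j k) (Icc 0 T) :=
  (h.continuousOn_aux k j hj).add
    ((contDiff_partialDeriv (hf j) k).continuous.comp_continuousOn h.continuousOn_action)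

theorem continuousOn_disagreement (h : IsTrajectoryOn f A dbar δ T x w)
    (hf : ∀ j, ContDiff ℝ 2 (f j)) :
    ContinuousOn (fun t => disagreement f (x t) (w t)) (Icc 0 T) :=
  continuousOn_finsetSum _ fun k _ => continuousOn_finsetSum _ fun _ hj =>
    ((h.continuousOn_gEst hf k hj).sub
      ((continuousOn_finsetSum _ fun _ hl => h.continuousOn_gEst hf k hl).div_const _)).pow 2

/-- The rate of change of the estimate `g_{jk}`. -/
theorem hasDerivWithinAt_gEst (h : IsTrajectoryOn f A dbar δ T x w)
    (hf : ∀ j, ContDiff ℝ 2 (f j)) (k : Fin m) {j : Fin m} (hj : j ∈ closedNbhd f k) {t : ℝ}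
    (ht : t ∈ Ico 0 T) :
    HasDerivWithinAt (fun t => gEst f (x t) (w t) j k)
      (auxVelocity f A (x t) (w t) j k +
        fderiv ℝ (partialDeriv (f j) k) (x t) (actionVelocity f dbar δ (x t) (w t))) (Ici t) t :=
  (h.aux t ht k j hj).add
    (((contDiff_partialDeriv (hf j) k).differentiable one_ne_zero
      (x t)).hasFDerivAt.comp_hasDerivWithinAt t (h.action t ht))

/-- The rate of change of the disagreement; the averages do not contribute. -/
theorem hasDerivWithinAt_disagreement (h : IsTrajectoryOn f A dbar δ T x w)
    (hf : ∀ j, ContDiff ℝ 2 (f j)) {t : ℝ} (ht : t ∈ Ico 0 T) :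
    HasDerivWithinAt (fun t => disagreement f (x t) (w t))
      (∑ k, ∑ j ∈ closedNbhd f k, 2 * gDev f (x t) (w t) j k *
        (auxVelocity f A (x t) (w t) j k +
          fderiv ℝ (partialDeriv (f j) k) (x t) (actionVelocity f dbar δ (x t) (w t))))
      (Ici t) t := by
  refine HasDerivWithinAt.fun_sum fun k _ => ?_
  set v : Fin m → ℝ := fun j => auxVelocity f A (x t) (w t) j k +
    fderiv ℝ (partialDeriv (f j) k) (x t) (actionVelocity f dbar δ (x t) (w t)) with hv
  set μ : ℝ := (∑ j ∈ closedNbhd f k, v j) / (closedNbhd f k).card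
  have hmean : HasDerivWithinAt (fun t => gMean f (x t) (w t) k) μ (Ici t) t :=
    (HasDerivWithinAt.fun_sum fun j hj => h.hasDerivWithinAt_gEst hf k hj ht).div_const _
  have hdev : ∀ j ∈ closedNbhd f k, HasDerivWithinAt (fun t => gDev f (x t) (w t) j k ^ 2)
      (2 * gDev f (x t) (w t) j k * (v j - μ)) (Ici t) t := by
    intro j hj
    have := ((h.hasDerivWithinAt_gEst hf k hj ht).sub hmean).fun_pow 2
    refine this.congr_deriv ?_
    simp [gDev, hv]
  refine (HasDerivWithinAt.fun_sum hdev).congr_deriv ?_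
  have hsum : ∑ j ∈ closedNbhd f k, 2 * gDev f (x t) (w t) j k * μ = 0 := by
    rw [← Finset.sum_mul, ← Finset.mul_sum, sum_gDev]
    simp
  simp only [mul_sub, Finset.sum_sub_distrib, hsum, sub_zero, hv]

end IsTrajectoryOn

/-! ### Decay of the disagreement -/

theorem sum_gDev_mul_auxVelocity_le {A : WeightedGraph (Fin m)} {c : ℝ}
    (hc : ∀ (k : Fin m) (ξ : Fin m → ℝ), ∑ j ∈ closedNbhd f k, ξ j = 0 →
      c * ∑ j ∈ closedNbhd f k, ξ j ^ 2 ≤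
        ∑ j ∈ closedNbhd f k, ξ j * ∑ l ∈ closedNbhd f k, A.weight j l * (ξ j - ξ l))
    (x : EuclideanSpace ℝ (Fin m)) (w : Fin m → Fin m → ℝ) (k : Fin m) :
    ∑ j ∈ closedNbhd f k, gDev f x w j k * auxVelocity f A x w j k ≤
      -c * ∑ j ∈ closedNbhd f k, gDev f x w j k ^ 2 := by
  have h1 := hc k (fun j => gDev f x w j k) (sum_gDev x w k)
  -- The average cancels in differences, so consensus acts on the deviations alone, which have zero
  -- sum.
  have h2 : ∑ j ∈ closedNbhd f k, gDev f x w j k * auxVelocity f A x w j k =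
      -∑ j ∈ closedNbhd f k, gDev f x w j k *
        ∑ l ∈ closedNbhd f k, A.weight j l * (gDev f x w j k - gDev f x w l k) := by
    simp only [auxVelocity, gDev, sub_sub_sub_cancel_right, mul_neg, Finset.sum_neg_distrib]
  rw [h2]
  linarith

/-- If the Hessian terms are at most `B` in size, the disagreement decays up to an error. -/
theorem disagreement_deriv_le {A : WeightedGraph (Fin m)} {c B : ℝ} (hc0 : 0 < c)
    (hc : ∀ (k : Fin m) (ξ : Fin m → ℝ), ∑ j ∈ closedNbhd f k, ξ j = 0 →
      c * ∑ j ∈ closedNbhd f k, ξ j ^ 2 ≤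
        ∑ j ∈ closedNbhd f k, ξ j * ∑ l ∈ closedNbhd f k, A.weight j l * (ξ j - ξ l))
    (x : EuclideanSpace ℝ (Fin m)) (w : Fin m → Fin m → ℝ) (b : Fin m → Fin m → ℝ)
    (hb : ∀ j k, |b j k| ≤ B) :
    ∑ k, ∑ j ∈ closedNbhd f k, 2 * gDev f x w j k * (auxVelocity f A x w j k + b j k) ≤
      -c * disagreement f x w + m ^ 2 * B ^ 2 / c := by
  -- Young's inequality, spending half of the rate `2 c` supplied by the Poincaré inequality.
  have hterm : ∀ j k, 2 * gDev f x w j k * b j k ≤ c * gDev f x w j k ^ 2 + B ^ 2 / c := by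
    intro j k
    have h1 : b j k ^ 2 ≤ B ^ 2 := sq_le_sq' (neg_le_of_abs_le (hb j k)) (le_of_abs_le (hb j k))
    have h2 : b j k ^ 2 / c ≤ B ^ 2 / c := div_le_div_of_nonneg_right h1 hc0.le
    have h3 : 0 ≤ (c * gDev f x w j k - b j k) ^ 2 / c := by positivity
    have h4 : (c * gDev f x w j k - b j k) ^ 2 / c =
        c * gDev f x w j k ^ 2 - 2 * gDev f x w j k * b j k + b j k ^ 2 / c := by
      field_simp
      ring
    linarith
  have hk : ∀ k, ∑ j ∈ closedNbhd f k,
      2 * gDev f x w j k * (auxVelocity f A x w j k + b j k) ≤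
        -c * ∑ j ∈ closedNbhd f k, gDev f x w j k ^ 2 + m * (B ^ 2 / c) := by
    intro k
    have h1 := sum_gDev_mul_auxVelocity_le hc x w k
    have h2 : ∑ j ∈ closedNbhd f k, 2 * gDev f x w j k * b j k ≤
        ∑ j ∈ closedNbhd f k, (c * gDev f x w j k ^ 2 + B ^ 2 / c) :=
      Finset.sum_le_sum fun j _ => hterm j k
    rw [Finset.sum_add_distrib, Finset.sum_const, nsmul_eq_mul, ← Finset.mul_sum] at h2
    have h3 : ((closedNbhd f k).card : ℝ) * (B ^ 2 / c) ≤ m * (B ^ 2 / c) :=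
      mul_le_mul_of_nonneg_right (card_closedNbhd_le k) (by positivity)
    have h4 : ∑ j ∈ closedNbhd f k, 2 * gDev f x w j k * (auxVelocity f A x w j k + b j k) =
        2 * ∑ j ∈ closedNbhd f k, gDev f x w j k * auxVelocity f A x w j k +
          ∑ j ∈ closedNbhd f k, 2 * gDev f x w j k * b j k := by
      rw [Finset.mul_sum, ← Finset.sum_add_distrib]
      exact Finset.sum_congr rfl fun j _ => by ring
    rw [h4]
    linarith
  refine (Finset.sum_le_sum fun k _ => hk k).trans_eq ?_
  rw [Finset.sum_add_distrib, ← Finset.mul_sum, disagreement, Finset.sum_const, Finset.card_univ,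
    Fintype.card_fin, nsmul_eq_mul]
  ring

/-! ### The slow Lyapunov function -/

/-- The weighted squared distance of the actions to the minimizer. -/
noncomputable def potential (f : Fin m → EuclideanSpace ℝ (Fin m) → ℝ) (dbar : Fin m → ℝ)
    (y : EuclideanSpace ℝ (Fin m)) : ℝ :=
  ∑ k, (closedNbhd f k).card / (2 * dbar k) * y k ^ 2

theorem continuous_potential (dbar : Fin m → ℝ) : Continuous (potential f dbar) := by
  unfold potential
  fun_prop

theorem exists_potential_bounds [Nonempty (Fin m)] {dbar : Fin m → ℝ}
    (hdbar : ∀ j, 0 < dbar j) :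
    ∃ p₁ p₂ : ℝ, 0 < p₁ ∧ 0 < p₂ ∧ ∀ y : EuclideanSpace ℝ (Fin m),
      p₁ * ‖y‖ ^ 2 ≤ potential f dbar y ∧ potential f dbar y ≤ p₂ * ‖y‖ ^ 2 := by
  have hp : ∀ k, 0 < ((closedNbhd f k).card : ℝ) / (2 * dbar k) := fun k =>
    div_pos (card_closedNbhd_pos k) (mul_pos two_pos (hdbar k))
  obtain ⟨k₁, hk₁⟩ := Finite.exists_min fun k => ((closedNbhd f k).card : ℝ) / (2 * dbar k)
  obtain ⟨k₂, hk₂⟩ := Finite.exists_max fun k => ((closedNbhd f k).card : ℝ) / (2 * dbar k)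
  refine ⟨_, _, hp k₁, hp k₂, fun y => ?_⟩
  simp only [potential, EuclideanSpace.norm_sq_eq, Real.norm_eq_abs, sq_abs, Finset.mul_sum]
  exact ⟨Finset.sum_le_sum fun k _ => mul_le_mul_of_nonneg_right (hk₁ k) (sq_nonneg _),
    Finset.sum_le_sum fun k _ => mul_le_mul_of_nonneg_right (hk₂ k) (sq_nonneg _)⟩

/-- The weights `n_k / (2 dbar_k)` cancel both the gains `dbar_k` and the factor `1 / n_k` of the
average, leaving the full inner product with the gradient. -/
theorem IsTrajectoryOn.hasDerivWithinAt_potential {A : WeightedGraph (Fin m)} {dbar : Fin m → ℝ}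
    {δ T : ℝ} {x : ℝ → EuclideanSpace ℝ (Fin m)} {w : ℝ → Fin m → Fin m → ℝ}
    (h : IsTrajectoryOn f A dbar δ T x w) (hf : ∀ j, Differentiable ℝ (f j))
    (hundirected : ∀ k, (commGraphTo f A k).IsUndirected) (hdbar : ∀ j, 0 < dbar j)
    (p : EuclideanSpace ℝ (Fin m)) {t : ℝ} (ht : t ∈ Ico 0 T) :
    HasDerivWithinAt (fun t => potential f dbar (x t - p))
      (-δ * inner ℝ (x t - p) (pseudoGradient f (x t)) -
        δ * ∑ k, (closedNbhd f k).card * (x t - p) k * gDev f (x t) (w t) k k) (Ici t) t := by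
  have hx : ∀ k, HasDerivWithinAt (fun t => (x t - p) k)
      (-(δ * dbar k) * gEst f (x t) (w t) k k) (Ici t) t := fun k =>
    (hasDerivWithinAt_euclidean.1 (h.action t ht) k).sub_const (p k)
  refine (HasDerivWithinAt.fun_sum fun k _ =>
    ((hx k).fun_pow 2).const_mul (((closedNbhd f k).card : ℝ) / (2 * dbar k))).congr_deriv ?_
  rw [PiLp.inner_apply, Finset.mul_sum, Finset.mul_sum, ← Finset.sum_sub_distrib]
  refine Finset.sum_congr rfl fun k _ => ?_
  rw [h.gEst_eq hf hundirected k k (Ico_subset_Icc_self ht)]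
  have h1 := (hdbar k).ne'
  have h2 := (card_closedNbhd_pos (f := f) k).ne'
  simp only [RCLike.inner_apply, conj_trivial]
  field_simp
  ring

/-! ### Estimates inside a fixed ball -/

theorem exists_bound_near (hf : ∀ j, ContDiff ℝ 2 (f j)) (p : EuclideanSpace ℝ (Fin m)) (ρ : ℝ) :
    ∃ M : ℝ, 0 ≤ M ∧ ∀ x, ‖x - p‖ ≤ ρ → (∀ k, |pseudoGradient f x k| ≤ M) ∧
      (∀ j k, |partialDeriv (f j) k x| ≤ M) ∧
      ∀ j k, ‖fderiv ℝ (partialDeriv (f j) k) x‖ ≤ M := by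
  have hc : Continuous fun x : EuclideanSpace ℝ (Fin m) => (pseudoGradient f x,
      (fun j k => partialDeriv (f j) k x), fun j k => fderiv ℝ (partialDeriv (f j) k) x) := by
    refine (continuous_pseudoGradient hf).prodMk (Continuous.prodMk ?_ ?_)
    · exact continuous_pi fun j => continuous_pi fun k =>
        (contDiff_partialDeriv (hf j) k).continuous
    · exact continuous_pi fun j => continuous_pi fun k =>
        (contDiff_partialDeriv (hf j) k).continuous_fderiv one_ne_zero
  obtain ⟨M, hM⟩ := (isCompact_closedBall p ρ).exists_bound_of_continuousOn hc.continuousOn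
  refine ⟨max M 0, le_max_right _ _, fun x hx => ?_⟩
  have h := (hM x (by simpa [dist_eq_norm] using hx)).trans (le_max_left M 0)
  have h1 := (norm_fst_le _).trans h
  have h2 := (norm_snd_le _).trans h
  refine ⟨fun k => ?_, fun j k => ?_, fun j k => ?_⟩
  · exact (PiLp.norm_apply_le (pseudoGradient f x) k).trans h1
  · exact ((norm_le_pi_norm _ k).trans (norm_le_pi_norm
      (fun j k => partialDeriv (f j) k x) j)).trans ((norm_fst_le _).trans h2)
  · exact ((norm_le_pi_norm _ k).trans (norm_le_pi_norm
      (fun j k => fderiv ℝ (partialDeriv (f j) k) x) j)).trans ((norm_snd_le _).trans h2)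

theorem mul_le_of_lt_div_add_one {δ e q : ℝ} (hδ : 0 < δ) (hq : 0 ≤ q) (h : δ < e / (q + 1)) :
    δ * q ≤ e := by
  have := (lt_div_iff₀ (by linarith : 0 < q + 1)).1 h
  linarith

theorem sqrt_add_le {a b : ℝ} (ha : 0 ≤ a) (hb : 0 ≤ b) : √(a + b) ≤ √a + √b := by
  refine Real.sqrt_le_iff.2 ⟨by positivity, ?_⟩
  rw [add_sq, Real.sq_sqrt ha, Real.sq_sqrt hb]
  have : 0 ≤ 2 * √a * √b := by positivity
  linarith

theorem euclidean_norm_le_sum (y : EuclideanSpace ℝ (Fin m)) : ‖y‖ ≤ ∑ j, |y j| := by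
  conv_lhs => rw [← (EuclideanSpace.basisFun (Fin m) ℝ).sum_repr y]
  refine (norm_sum_le _ _).trans_eq (Finset.sum_congr rfl fun j _ => ?_)
  simp [norm_smul]

theorem norm_actionVelocity_le {dbar : Fin m → ℝ} (hdbar : ∀ j, 0 < dbar j) {δ G : ℝ}
    (hδ : 0 < δ) {x : EuclideanSpace ℝ (Fin m)} {w : Fin m → Fin m → ℝ}
    (hG : ∀ j, |gEst f x w j j| ≤ G) :
    ‖actionVelocity f dbar δ x w‖ ≤ δ * ((∑ j, dbar j) * G) := by
  refine (euclidean_norm_le_sum _).trans ?_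
  rw [Finset.sum_mul, Finset.mul_sum]
  refine Finset.sum_le_sum fun j _ => ?_
  simp only [actionVelocity, abs_mul, abs_neg, abs_of_pos hδ, abs_of_pos (hdbar j)]
  rw [← mul_assoc]
  exact mul_le_mul_of_nonneg_left (hG j) (mul_nonneg hδ.le (hdbar j).le)

theorem abs_sum_card_mul_le {x y : EuclideanSpace ℝ (Fin m)} {w : Fin m → Fin m → ℝ} {ρ : ℝ}
    (hρ : 0 ≤ ρ) (hy : ‖y‖ ≤ ρ) :
    |∑ k, (closedNbhd f k).card * y k * gDev f x w k k| ≤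
      m ^ 2 * ρ * √(disagreement f x w) := by
  refine (Finset.abs_sum_le_sum_abs _ _).trans ?_
  have h1 : ∀ k ∈ Finset.univ, |(closedNbhd f k).card * y k * gDev f x w k k| ≤
      m * ρ * √(disagreement f x w) := by
    intro k _
    rw [abs_mul, abs_mul, Nat.abs_cast]
    have h2 := card_closedNbhd_le (f := f) k
    have h3 : |y k| ≤ ρ := (PiLp.norm_apply_le y k).trans hy
    have h4 := abs_gDev_le_sqrt_disagreement (f := f) x w (self_mem_closedNbhd k)
    gcongr
  refine (Finset.sum_le_sum h1).trans_eq ?_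
  rw [Finset.sum_const, Finset.card_univ, Fintype.card_fin, nsmul_eq_mul]
  ring

namespace IsTrajectoryOn

variable {A : WeightedGraph (Fin m)} {dbar : Fin m → ℝ} {δ T : ℝ}
  {x : ℝ → EuclideanSpace ℝ (Fin m)} {w : ℝ → Fin m → Fin m → ℝ}

theorem abs_gEst_le (h : IsTrajectoryOn f A dbar δ T x w) (hf : ∀ j, Differentiable ℝ (f j))
    (hundirected : ∀ k, (commGraphTo f A k).IsUndirected) {t ρ M : ℝ} (ht : t ∈ Icc 0 T)
    (hU : √(disagreement f (x t) (w t)) ≤ ρ) (hM : ∀ k, |pseudoGradient f (x t) k| ≤ M)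
    {j k : Fin m} (hj : j ∈ closedNbhd f k) : |gEst f (x t) (w t) j k| ≤ ρ + M := by
  rw [h.gEst_eq hf hundirected j k ht]
  refine (abs_add_le _ _).trans (add_le_add ?_ ?_)
  · exact (abs_gDev_le_sqrt_disagreement _ _ hj).trans hU
  · rw [abs_div, Nat.abs_cast]
    have : (1 : ℝ) ≤ (closedNbhd f k).card := by
      exact_mod_cast Finset.card_pos.2 ⟨k, self_mem_closedNbhd k⟩
    exact (div_le_self (abs_nonneg _) this).trans (hM k)

/-- The decay estimate for a trajectory in a region where the bound `M` on the derivatives of the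
costs is available. -/
theorem decay (h : IsTrajectoryOn f A dbar δ T x w) (hf : ∀ j, ContDiff ℝ 2 (f j))
    (hundirected : ∀ k, (commGraphTo f A k).IsUndirected) (hdbar : ∀ j, 0 < dbar j)
    {p : EuclideanSpace ℝ (Fin m)} {α : ℝ → ℝ} (hα : IsClassK α)
    (hαle : ∀ x, α ‖x - p‖ ≤ inner ℝ (x - p) (pseudoGradient f x))
    {p₁ p₂ : ℝ} (hp₁ : 0 < p₁) (hp₂ : 0 < p₂)
    (hpot : ∀ y, p₁ * ‖y‖ ^ 2 ≤ potential f dbar y ∧ potential f dbar y ≤ p₂ * ‖y‖ ^ 2)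
    {c : ℝ} (hc0 : 0 < c)
    (hc : ∀ (k : Fin m) (ξ : Fin m → ℝ), ∑ j ∈ closedNbhd f k, ξ j = 0 →
      c * ∑ j ∈ closedNbhd f k, ξ j ^ 2 ≤
        ∑ j ∈ closedNbhd f k, ξ j * ∑ l ∈ closedNbhd f k, A.weight j l * (ξ j - ξ l))
    {β : ℝ → ℝ → ℝ}
    (hβ : ∀ r s, 0 ≤ r → 0 ≤ s →
      0 ≤ β r s ∧ β r s + s * (α √(β r s / p₂) / 2) = r)
    {ρ M D K ε : ℝ} (hρ : 0 ≤ ρ) (hM0 : 0 ≤ M)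
    (hM : ∀ x, ‖x - p‖ ≤ ρ → (∀ k, |pseudoGradient f x k| ≤ M) ∧
      (∀ j k, |partialDeriv (f j) k x| ≤ M) ∧
      ∀ j k, ‖fderiv ℝ (partialDeriv (f j) k) x‖ ≤ M)
    (hregion : ∀ t ∈ Icc 0 T, disagreement f (x t) (w t) + ‖x t - p‖ ^ 2 ≤ ρ ^ 2)
    (hD : 0 ≤ D) (hε : 0 < ε) (h0 : √(disagreement f (x 0) (w 0)) ≤ D) (hδ : 0 < δ)
    (hK : K = m ^ 2 * (M * ((∑ j, dbar j) * (ρ + M))) ^ 2 / c)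
    (hδ1 : δ * (2 * (m ^ 2 * ρ) * D / c) ≤ ε)
    (hδ2 : δ * (m ^ 2 * ρ * √(K / c)) ≤ α √(ε / p₂) / 2) :
    ∀ t ∈ Icc 0 T,
      √(disagreement f (x t) (w t)) ≤
        √(disagreement f (x 0) (w 0)) * Real.exp (-(c / 2 * t)) + δ * √(K / c) ∧
      potential f dbar (x t - p) ≤ β (potential f dbar (x 0 - p)) (δ * t) + 2 * ε := by
  have hfd : ∀ j, Differentiable ℝ (f j) := fun j => (hf j).differentiable two_ne_zero
  have hU : ∀ t ∈ Icc 0 T, √(disagreement f (x t) (w t)) ≤ ρ := fun t ht =>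
    (Real.sqrt_le_sqrt ((le_add_of_nonneg_right (sq_nonneg _)).trans (hregion t ht))).trans_eq
      (Real.sqrt_sq hρ)
  have hy : ∀ t ∈ Icc 0 T, ‖x t - p‖ ≤ ρ := fun t ht =>
    abs_le_of_sq_le_sq' ((le_add_of_nonneg_left (disagreement_nonneg _ _)).trans
      (hregion t ht)) hρ |>.2
  have hV0 : ∀ y, 0 ≤ potential f dbar y := fun y =>
    (mul_nonneg hp₁.le (sq_nonneg _)).trans (hpot y).1
  refine two_time_scale_bound (hα.half_comp_sqrt_div hp₂) hβ (K := K)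
    (C := m ^ 2 * ρ) hδ hc0 (by rw [hK]; positivity) (by positivity) hD hε
    (h.continuousOn_disagreement hf) (fun t ht => h.hasDerivWithinAt_disagreement hf ht)
    ((continuous_potential dbar).comp_continuousOn
      (h.continuousOn_action.sub continuousOn_const))
    (fun t ht => h.hasDerivWithinAt_potential hfd hundirected hdbar p ht)
    (fun t => disagreement_nonneg _ _) (fun t => hV0 _) h0 ?_ ?_ hδ1 hδ2
  · intro t ht
    have ht' := Ico_subset_Icc_self ht
    have hMt := hM (x t) (hy t ht')
    have hvel := norm_actionVelocity_le hdbar hδ fun j =>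
      h.abs_gEst_le hfd hundirected ht' (hU t ht') hMt.1 (self_mem_closedNbhd j)
    refine (disagreement_deriv_le hc0 hc (x t) (w t)
      (fun j k => fderiv ℝ (partialDeriv (f j) k) (x t) (actionVelocity f dbar δ (x t) (w t)))
      (B := M * (δ * ((∑ j, dbar j) * (ρ + M)))) fun j k => ?_).trans_eq ?_
    · exact (ContinuousLinearMap.le_opNorm _ _).trans
        (mul_le_mul (hMt.2.2 j k) hvel (norm_nonneg _) hM0)
    · rw [hK]
      ring
  · intro t ht
    have ht' := Ico_subset_Icc_self ht
    have h1 := (abs_le.1 (abs_sum_card_mul_le (f := f) (x := x t) (w := w t) hρ (hy t ht'))).1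
    have h2 : √(potential f dbar (x t - p) / p₂) ≤ ‖x t - p‖ :=
      Real.sqrt_le_iff.2 ⟨norm_nonneg _, (div_le_iff₀' hp₂).2 (hpot _).2⟩
    have h3 := (hα.strictMonoOn.monotoneOn (mem_Ici.2 (Real.sqrt_nonneg _))
      (mem_Ici.2 (norm_nonneg _)) h2).trans (hαle (x t))
    have h4 := mul_le_mul_of_nonneg_left h3 hδ.le
    have h5 := mul_le_mul_of_nonneg_left h1 hδ.le
    linarith

end IsTrajectoryOn

/-! ### Choice of the ball and of the range of `δ` -/

/-- Uniform decay estimate for all trajectories with small parameter `δ`. -/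
theorem exists_uniform_decay [Nonempty (Fin m)] (hf : ∀ j, ContDiff ℝ 2 (f j))
    (hmono : ∀ x y : EuclideanSpace ℝ (Fin m), x ≠ y →
      0 < inner ℝ (x - y) (pseudoGradient f x - pseudoGradient f y))
    {xstar : EuclideanSpace ℝ (Fin m)} (hxstar : IsMinOn (socialCost f) univ xstar)
    {A : WeightedGraph (Fin m)} (hundirected : ∀ k, (commGraphTo f A k).IsUndirected)
    (hconnected : ∀ k, (commGraphTo f A k).IsConnected)
    {dbar : Fin m → ℝ} (hdbar : ∀ j, 0 < dbar j) :
    ∃ (β : ℝ → ℝ → ℝ) (p₁ p₂ : ℝ), IsClassKL β ∧ 0 < p₁ ∧ 0 < p₂ ∧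
      ∀ Δ ε, 0 < Δ → 0 < ε → ε ≤ 1 → ∃ ρ δstar : ℝ, 0 < ρ ∧ 0 < δstar ∧
        ∀ δ, 0 < δ → δ < δstar → ∀ T, ∀ x w, IsTrajectoryOn f A dbar δ T x w →
          disagreement f (x 0) (w 0) + ‖x 0 - xstar‖ ^ 2 < Δ ^ 2 → ∀ t ∈ Icc 0 T,
            disagreement f (x t) (w t) + ‖x t - xstar‖ ^ 2 < ρ ^ 2 ∧
            √(disagreement f (x t) (w t)) ≤
              √(disagreement f (x 0) (w 0)) * Real.exp (-(δ * t)) + ε ∧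
            p₁ * ‖x t - xstar‖ ^ 2 ≤ β (p₂ * ‖x 0 - xstar‖ ^ 2) (δ * t) + 2 * ε := by
  obtain ⟨α, hα, hαle⟩ := exists_isClassK_le_inner (continuous_pseudoGradient hf) hmono
    (pseudoGradient_eq_zero hxstar)
  obtain ⟨p₁, p₂, hp₁, hp₂, hpot⟩ := exists_potential_bounds (f := f) hdbar
  obtain ⟨c, hc0, hc⟩ := exists_poincare_closedNbhd hundirected hconnected
  have ha := hα.half_comp_sqrt_div hp₂
  obtain ⟨β, hβKL, hβ⟩ := exists_isClassKL_add_mul_eq ha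
  have haε : ∀ ε, 0 < ε → 0 < α √(ε / p₂) / 2 := fun ε hε => by
    have := ha.strictMonoOn (mem_Ici.2 le_rfl) (mem_Ici.2 hε.le) hε
    rwa [ha.map_zero] at this
  have hβle : ∀ r s, 0 ≤ r → 0 ≤ s → β r s ≤ r := fun r s hr hs => by
    have h1 := hβKL.antitoneOn r hr (mem_Ici.2 le_rfl) (mem_Ici.2 hs) hs
    have h2 := (hβ r 0 hr le_rfl).2
    linarith
  have hV0 : ∀ y, 0 ≤ potential f dbar y := fun y =>
    (mul_nonneg hp₁.le (sq_nonneg _)).trans (hpot y).1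
  refine ⟨β, p₁, p₂, hβKL, hp₁, hp₂, fun Δ ε hΔ hε hε1 => ?_⟩
  -- The first two terms bound the disagreement and the squared distance under the decay estimates
  -- with `ε ≤ 1`; the final `1` makes the inclusion strict.
  set ρ : ℝ := √((Δ + 1) ^ 2 + (p₂ * Δ ^ 2 + 2) / p₁ + 1) with hρ
  have hρpos : 0 < ρ := Real.sqrt_pos.2 (by positivity)
  have hρsq : ρ ^ 2 = (Δ + 1) ^ 2 + (p₂ * Δ ^ 2 + 2) / p₁ + 1 := Real.sq_sqrt (by positivity)
  obtain ⟨M, hM0, hM⟩ := exists_bound_near hf xstar ρ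
  set K : ℝ := m ^ 2 * (M * ((∑ j, dbar j) * (ρ + M))) ^ 2 / c with hK
  have hdpos : 0 ≤ ∑ j, dbar j := Finset.sum_nonneg fun j _ => (hdbar j).le
  -- In order: consensus decays no slower than `exp (-(δ t))`; the residual disagreement is at most
  -- `ε`; the accumulated transient is at most `ε`; the persistent coupling is at most the decay
  -- rate at level `ε`. Each `+ 1` avoids a zero denominator.
  refine ⟨ρ, min (min (c / 2) (ε / (√(K / c) + 1)))
    (min (ε / (2 * (m ^ 2 * ρ) * Δ / c + 1))
      (α √(ε / p₂) / 2 / (m ^ 2 * ρ * √(K / c) + 1))), hρpos, ?_, ?_⟩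
  · have := haε ε hε
    refine lt_min (lt_min ?_ ?_) (lt_min ?_ ?_) <;> positivity
  intro δ hδ hδlt T x w h h0
  rw [lt_min_iff, lt_min_iff, lt_min_iff] at hδlt
  obtain ⟨⟨hδ1, hδ2⟩, hδ3, hδ4⟩ := hδlt
  replace hδ2 := mul_le_of_lt_div_add_one hδ (by positivity) hδ2
  replace hδ3 := mul_le_of_lt_div_add_one hδ (by positivity) hδ3
  replace hδ4 := mul_le_of_lt_div_add_one hδ (by positivity) hδ4
  have hU0 : √(disagreement f (x 0) (w 0)) ≤ Δ :=
    (Real.sqrt_le_sqrt (by nlinarith [sq_nonneg ‖x 0 - xstar‖])).trans_eq (Real.sqrt_sq hΔ.le)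
  have hy0 : ‖x 0 - xstar‖ ^ 2 ≤ Δ ^ 2 := by
    linarith [disagreement_nonneg (f := f) (x 0) (w 0)]
  have hest : ∀ t, 0 ≤ t → t ≤ T →
      (∀ τ ∈ Icc 0 t, disagreement f (x τ) (w τ) + ‖x τ - xstar‖ ^ 2 ≤ ρ ^ 2) →
      √(disagreement f (x t) (w t)) ≤
        √(disagreement f (x 0) (w 0)) * Real.exp (-(δ * t)) + ε ∧
      p₁ * ‖x t - xstar‖ ^ 2 ≤ β (p₂ * ‖x 0 - xstar‖ ^ 2) (δ * t) + 2 * ε := by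
    intro t ht0 htT hreg
    obtain ⟨h1, h2⟩ := (h.mono htT).decay hf hundirected hdbar hα hαle hp₁ hp₂ hpot hc0 hc hβ
      hρpos.le hM0 hM hreg hΔ.le hε hU0 hδ hK hδ3 hδ4 t ⟨ht0, le_rfl⟩
    have h3 : Real.exp (-(c / 2 * t)) ≤ Real.exp (-(δ * t)) :=
      Real.exp_le_exp.2 (neg_le_neg (mul_le_mul_of_nonneg_right hδ1.le ht0))
    have h4 := mul_le_mul_of_nonneg_left h3 (Real.sqrt_nonneg (disagreement f (x 0) (w 0)))
    have h5 : 0 ≤ δ * t := mul_nonneg hδ.le ht0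
    have h6 := (hβKL.isClassK _ h5).strictMonoOn.monotoneOn (mem_Ici.2 (hV0 _))
      (mem_Ici.2 (by positivity)) (hpot (x 0 - xstar)).2
    exact ⟨by linarith, by linarith [(hpot (x t - xstar)).1]⟩
  have hsmall : ∀ t, 0 ≤ t → t ≤ T →
      (∀ τ ∈ Icc 0 t, disagreement f (x τ) (w τ) + ‖x τ - xstar‖ ^ 2 ≤ ρ ^ 2) →
      disagreement f (x t) (w t) + ‖x t - xstar‖ ^ 2 < ρ ^ 2 := by
    intro t ht0 htT hreg
    obtain ⟨h1, h2⟩ := hest t ht0 htT hreg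
    have h5 : 0 ≤ δ * t := mul_nonneg hδ.le ht0
    have h6 : √(disagreement f (x t) (w t)) ≤ Δ + 1 := by
      have := mul_le_mul hU0 (Real.exp_le_one_iff.2 (neg_nonpos.2 h5)) (Real.exp_pos _).le hΔ.le
      linarith
    have h7 : disagreement f (x t) (w t) ≤ (Δ + 1) ^ 2 := by
      rw [← Real.sq_sqrt (disagreement_nonneg (f := f) (x t) (w t))]
      exact pow_le_pow_left₀ (Real.sqrt_nonneg _) h6 2
    have h8 : ‖x t - xstar‖ ^ 2 ≤ (p₂ * Δ ^ 2 + 2) / p₁ := by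
      rw [le_div_iff₀' hp₁]
      have := hβle _ _ (by positivity : 0 ≤ p₂ * ‖x 0 - xstar‖ ^ 2) h5
      have := mul_le_mul_of_nonneg_left hy0 hp₂.le
      linarith
    linarith
  intro t ht
  have hall := lt_of_forall_Icc_le_imp_lt
    (N := fun t => disagreement f (x t) (w t) + ‖x t - xstar‖ ^ 2) (ρ := ρ ^ 2)
    ((h.continuousOn_disagreement hf).add
      ((h.continuousOn_action.sub continuousOn_const).norm.pow 2))
    (fun t ht => hsmall t ht.1 ht.2)
    (by
      have : 0 ≤ (p₂ * Δ ^ 2 + 2) / p₁ := by positivity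
      nlinarith)
  exact ⟨hall t ht, hest t ht.1 ht.2 fun τ hτ => (hall τ ⟨hτ.1, hτ.2.trans ht.2⟩).le⟩

/-! ### Existence of trajectories -/

/-- The vector field of the seeking strategy; entries of `w` that are not used are at rest. -/
noncomputable def seekingField (f : Fin m → EuclideanSpace ℝ (Fin m) → ℝ)
    (A : WeightedGraph (Fin m)) (dbar : Fin m → ℝ) (δ : ℝ)
    (z : EuclideanSpace ℝ (Fin m) × (Fin m → Fin m → ℝ)) :
    EuclideanSpace ℝ (Fin m) × (Fin m → Fin m → ℝ) :=
  (actionVelocity f dbar δ z.1 z.2,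
    fun j k => if j ∈ closedNbhd f k then auxVelocity f A z.1 z.2 j k else 0)

theorem contDiff_seekingField (hf : ∀ j, ContDiff ℝ 2 (f j)) (A : WeightedGraph (Fin m))
    (dbar : Fin m → ℝ) (δ : ℝ) : ContDiff ℝ 1 (seekingField f A dbar δ) := by
  have hg : ∀ j k, ContDiff ℝ 1 fun z : EuclideanSpace ℝ (Fin m) × (Fin m → Fin m → ℝ) =>
      gEst f z.1 z.2 j k := fun j k => by
    have h1 := (contDiff_partialDeriv (hf j) k).comp
      (contDiff_fst (E := EuclideanSpace ℝ (Fin m)) (F := Fin m → Fin m → ℝ))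
    exact ContDiff.add (by fun_prop) h1
  refine ContDiff.prodMk ?_ ?_
  · exact contDiff_euclidean.2 fun j => contDiff_const.mul (hg j j)
  · refine contDiff_pi.2 fun j => contDiff_pi.2 fun k => ?_
    by_cases hj : j ∈ closedNbhd f k
    · simp only [hj, if_true, auxVelocity]
      exact (ContDiff.sum fun l _ => contDiff_const.mul ((hg j k).sub (hg l k))).neg
    · simp only [hj, if_false]
      exact contDiff_const

theorem hasDerivWithinAt_components {z : ℝ → EuclideanSpace ℝ (Fin m) × (Fin m → Fin m → ℝ)}
    {v : EuclideanSpace ℝ (Fin m) × (Fin m → Fin m → ℝ)} {s : Set ℝ} {t : ℝ}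
    (h : HasDerivWithinAt z v s t) :
    HasDerivWithinAt (fun t => (z t).1) v.1 s t ∧
      ∀ j k, HasDerivWithinAt (fun t => (z t).2 j k) (v.2 j k) s t := by
  refine ⟨(ContinuousLinearMap.fst ℝ (EuclideanSpace ℝ (Fin m))
    (Fin m → Fin m → ℝ)).hasFDerivAt.comp_hasDerivWithinAt t h, fun j k => ?_⟩
  exact hasDerivWithinAt_pi.1 (hasDerivWithinAt_pi.1
    ((ContinuousLinearMap.snd ℝ (EuclideanSpace ℝ (Fin m))
      (Fin m → Fin m → ℝ)).hasFDerivAt.comp_hasDerivWithinAt t h) j) k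

/-- Trajectories exist for all times if those on bounded intervals stay in a bounded region. -/
theorem exists_isTrajectory (hf : ∀ j, ContDiff ℝ 2 (f j)) {A : WeightedGraph (Fin m)}
    (hundirected : ∀ k, (commGraphTo f A k).IsUndirected) {dbar : Fin m → ℝ} {δ ρ : ℝ}
    (hρ : 0 < ρ) (p x₀ : EuclideanSpace ℝ (Fin m))
    (hbound : ∀ T, ∀ x w, IsTrajectoryOn f A dbar δ T x w → x 0 = x₀ → w 0 = 0 →
      ∀ t ∈ Icc 0 T, disagreement f (x t) (w t) + ‖x t - p‖ ^ 2 < ρ ^ 2) :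
    ∃ x w, IsTrajectory f A dbar δ x w ∧ x 0 = x₀ ∧ w 0 = 0 := by
  have hfd : ∀ j, Differentiable ℝ (f j) := fun j => (hf j).differentiable two_ne_zero
  obtain ⟨M, hM0, hM⟩ := exists_bound_near hf p ρ
  obtain ⟨z, hz0, hz⟩ := exists_solution_of_a_priori_bound (contDiff_seekingField hf A dbar δ)
    (x₀, 0) (ρ + ‖p‖ + 2 * M + 1) (fun T hT z hz0 hzc hz => by
      have htraj : IsTrajectoryOn f A dbar δ T (fun t => (z t).1) (fun t => (z t).2) :=
        { continuousOn_action := hzc.fst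
          continuousOn_aux := fun k j _ =>
            (continuous_apply_apply j k).comp_continuousOn hzc.snd
          action := fun t ht => (hasDerivWithinAt_components (hz t ht)).1
          aux := fun t ht k j hj => by
            simpa [seekingField, hj] using (hasDerivWithinAt_components (hz t ht)).2 j k
          aux_zero := fun k j _ => by simp [hz0] }
      have hTmem : T ∈ Icc 0 T := ⟨hT, le_rfl⟩
      have hreg := hbound T _ _ htraj (by simp [hz0]) (by simp [hz0]) T hTmem
      have hU : √(disagreement f (z T).1 (z T).2) ≤ ρ :=
        (Real.sqrt_le_sqrt ((le_add_of_nonneg_right (sq_nonneg _)).trans hreg.le)).trans_eq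
          (Real.sqrt_sq hρ.le)
      have hy : ‖(z T).1 - p‖ ≤ ρ :=
        abs_le_of_sq_le_sq' ((le_add_of_nonneg_left (disagreement_nonneg _ _)).trans
          hreg.le) hρ.le |>.2
      have hx : ‖(z T).1‖ ≤ ρ + ‖p‖ := by
        have := norm_add_le ((z T).1 - p) p
        rw [sub_add_cancel] at this
        linarith
      have hMT := hM _ hy
      -- Used entries are `g_{jk} - ∂f_j/∂x_k` with both terms bounded in the ball; unused entries
      -- stay at their initial value zero.
      have hw : ‖(z T).2‖ ≤ ρ + 2 * M := by
        have h0 : 0 ≤ ρ + 2 * M := by positivity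
        refine (pi_norm_le_iff_of_nonneg h0).2 fun j => (pi_norm_le_iff_of_nonneg h0).2 fun k => ?_
        by_cases hj : j ∈ closedNbhd f k
        · have h1 := htraj.abs_gEst_le hfd hundirected hTmem hU hMT.1 hj
          have h2 := hMT.2.1 j k
          have h3 : (z T).2 j k = gEst f (z T).1 (z T).2 j k - partialDeriv (f j) k (z T).1 := by
            simp [gEst]
          rw [h3, Real.norm_eq_abs]
          exact (abs_sub _ _).trans (by linarith)
        · have h1 := constant_of_has_deriv_right_zero (f := fun t => (z t).2 j k)
            ((continuous_apply_apply j k).comp_continuousOn hzc.snd)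
            (fun t ht => by
              simpa [seekingField, hj] using (hasDerivWithinAt_components (hz t ht)).2 j k)
            T hTmem
          have h2 : (z T).2 j k = 0 := h1.trans (by simp [hz0])
          simpa [h2] using h0
      have := norm_nonneg p
      rw [Prod.norm_def]
      exact max_lt (by linarith) (by linarith))
  refine ⟨fun t => (z t).1, fun t => (z t).2, ⟨fun t ht => ?_, fun t ht j k hk => ?_, ?_⟩,
    by simp [hz0], by simp [hz0]⟩
  · exact hasDerivWithinAt_euclidean.1 (hasDerivWithinAt_components (hz t ht)).1
  · have := (hasDerivWithinAt_components (hz t ht)).2 j k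
    simpa [seekingField, mem_closedNbhd_comm.1 hk, auxVelocity] using this
  · intro j k _
    simp [hz0]

end CoalitionGame

/-! ### The estimate for `χ` -/

theorem corollary2 (m : ℕ) (hm : 2 ≤ m)
    (f : Fin m → EuclideanSpace ℝ (Fin m) → ℝ)
    (hf : ∀ j, ContDiff ℝ 2 (f j))
    (hmono : ∀ x y : EuclideanSpace ℝ (Fin m), x ≠ y →
      0 < inner ℝ (x - y) (CoalitionGame.pseudoGradient f x - CoalitionGame.pseudoGradient f y))
    (xstar : EuclideanSpace ℝ (Fin m))
    (hxstar : IsMinOn (CoalitionGame.socialCost f) Set.univ xstar)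
    (hI : (CoalitionGame.interferenceGraph f).Connected)
    (A : CoalitionGame.WeightedGraph (Fin m))
    (hundirected : ∀ k, (CoalitionGame.commGraphTo f A k).IsUndirected)
    (hconnected : ∀ k, (CoalitionGame.commGraphTo f A k).IsConnected)
    (dbar : Fin m → ℝ) (hdbar : ∀ j, 0 < dbar j)
    (R : ∀ k, Matrix (CoalitionGame.closedNbhd f k)
      (Fin ((CoalitionGame.closedNbhd f k).card - 1)) ℝ)
    (hR : ∀ k, CoalitionGame.IsOrthogonalCompletion (R k)) :
    ∃ φ : ℝ → ℝ → ℝ, CoalitionGame.IsClassKL φ ∧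
      ∀ Δ v : ℝ, 0 < Δ → 0 < v → ∃ δstar : ℝ, 0 < δstar ∧
        ∀ δ : ℝ, 0 < δ → δ < δstar →
          -- trajectories exist for all times
          (∀ x₀ : EuclideanSpace ℝ (Fin m),
            ‖CoalitionGame.chi f R xstar x₀ 0‖ < Δ →
            ∃ (x : ℝ → EuclideanSpace ℝ (Fin m)) (w : ℝ → Fin m → Fin m → ℝ),
              CoalitionGame.IsTrajectory f A dbar δ x w ∧ x 0 = x₀) ∧
          -- every trajectory satisfies the estimate
          (∀ (x : ℝ → EuclideanSpace ℝ (Fin m)) (w : ℝ → Fin m → Fin m → ℝ),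
            CoalitionGame.IsTrajectory f A dbar δ x w →
            ‖CoalitionGame.chi f R xstar (x 0) (w 0)‖ < Δ →
            (∀ t, 0 ≤ t →
              ‖CoalitionGame.chi f R xstar (x t) (w t)‖ ≤
                φ ‖CoalitionGame.chi f R xstar (x 0) (w 0)‖ (δ * t) + v) ∧
            (∀ r, v < r → ∀ᶠ t in Filter.atTop, ‖x t - xstar‖ < r)) := by
  have : Nonempty (Fin m) := ⟨⟨0, by omega⟩⟩
  obtain ⟨β, p₁, p₂, hβ, hp₁, hp₂, hdecay⟩ := CoalitionGame.exists_uniform_decay hf hmono hxstar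
    hundirected hconnected hdbar
  have hφ := hβ.const_mul_sqrt_comp_add (K := (√p₁)⁻¹) (inv_nonneg.2 (Real.sqrt_nonneg _)) hp₂.le
  refine ⟨_, hφ, fun Δ v hΔ hv => ?_⟩
  obtain ⟨ε, hε, hε1, hεv⟩ : ∃ ε : ℝ, 0 < ε ∧ ε ≤ 1 ∧ ε + √(2 * ε / p₁) ≤ v := by
    -- The residuals `ε` of the disagreement and `√(2 ε / p₁)` of the distance receive `v / 2` each.
    refine ⟨min 1 (min (v / 2) (p₁ * v ^ 2 / 8)), by positivity, min_le_left _ _, ?_⟩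
    set ε := min 1 (min (v / 2) (p₁ * v ^ 2 / 8))
    have h1 : ε ≤ v / 2 := (min_le_right _ _).trans (min_le_left _ _)
    have h2 : ε ≤ p₁ * v ^ 2 / 8 := (min_le_right _ _).trans (min_le_right _ _)
    have h3 : √(2 * ε / p₁) ≤ v / 2 := Real.sqrt_le_iff.2 ⟨by positivity, by
      rw [div_le_iff₀ hp₁]
      linarith⟩
    linarith
  obtain ⟨ρ, δstar, hρ, hδstar, hest⟩ := hdecay Δ ε hΔ hε hε1
  refine ⟨δstar, hδstar, fun δ hδ hδlt => ⟨fun x₀ hx₀ => ?_, fun x w hxw h0 => ?_⟩⟩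
  · obtain ⟨x, w, hxw, hx0, -⟩ := CoalitionGame.exists_isTrajectory (δ := δ) (dbar := dbar) hf
      hundirected hρ xstar x₀ fun T x w hxw hx0 hw0 t ht => by
        refine (hest δ hδ hδlt T x w hxw ?_ t ht).1
        rw [hx0, hw0, ← CoalitionGame.norm_chi_sq hR]
        exact pow_lt_pow_left₀ hx₀ (norm_nonneg _) two_ne_zero
    exact ⟨x, w, hxw, hx0⟩
  · have hchi : ∀ t, 0 ≤ t → ‖CoalitionGame.chi f R xstar (x t) (w t)‖ ≤
        ((√p₁)⁻¹ * √(β (p₂ * ‖CoalitionGame.chi f R xstar (x 0) (w 0)‖ ^ 2) (δ * t)) +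
          ‖CoalitionGame.chi f R xstar (x 0) (w 0)‖ * Real.exp (-(δ * t))) + v := by
      intro t ht
      set r := ‖CoalitionGame.chi f R xstar (x 0) (w 0)‖ with hr
      have hr2 := CoalitionGame.norm_chi_sq hR xstar (x 0) (w 0)
      rw [← hr] at hr2
      have hδt : 0 ≤ δ * t := mul_nonneg hδ.le ht
      obtain ⟨-, h1, h2⟩ := hest δ hδ hδlt t x w (hxw.isTrajectoryOn t)
        (by rw [← hr2]; exact pow_lt_pow_left₀ h0 (norm_nonneg _) two_ne_zero) t ⟨ht, le_rfl⟩
      have hU0 : √(CoalitionGame.disagreement f (x 0) (w 0)) ≤ r :=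
        Real.sqrt_le_iff.2 ⟨norm_nonneg _, by rw [hr2]; linarith [sq_nonneg ‖x 0 - xstar‖]⟩
      have h3 : p₂ * ‖x 0 - xstar‖ ^ 2 ≤ p₂ * r ^ 2 := by
        refine mul_le_mul_of_nonneg_left ?_ hp₂.le
        rw [hr2]
        linarith [CoalitionGame.disagreement_nonneg (f := f) (x 0) (w 0)]
      have h4 := (hβ.isClassK _ hδt).strictMonoOn.monotoneOn (mem_Ici.2 (by positivity))
        (mem_Ici.2 (by positivity)) h3
      have hβ0 : 0 ≤ β (p₂ * r ^ 2) (δ * t) := by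
        have := (hβ.isClassK _ hδt).strictMonoOn.monotoneOn (mem_Ici.2 le_rfl)
          (mem_Ici.2 (by positivity)) (by positivity : 0 ≤ p₂ * r ^ 2)
        rwa [(hβ.isClassK _ hδt).map_zero] at this
      have h5 : ‖x t - xstar‖ ≤ (√p₁)⁻¹ * √(β (p₂ * r ^ 2) (δ * t)) + √(2 * ε / p₁) := by
        have e1 : ‖x t - xstar‖ ≤ √(β (p₂ * r ^ 2) (δ * t) / p₁ + 2 * ε / p₁) := by
          refine Real.le_sqrt_of_sq_le ?_
          rw [← add_div, le_div_iff₀' hp₁]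
          linarith
        refine (e1.trans (CoalitionGame.sqrt_add_le (by positivity) (by positivity))).trans_eq ?_
        rw [Real.sqrt_div' _ hp₁.le, div_eq_inv_mul]
      have h6 : ‖CoalitionGame.chi f R xstar (x t) (w t)‖ ≤
          √(CoalitionGame.disagreement f (x t) (w t)) + ‖x t - xstar‖ := by
        refine abs_le_of_sq_le_sq' ?_ (by positivity) |>.2
        rw [CoalitionGame.norm_chi_sq hR, add_sq,
          Real.sq_sqrt (CoalitionGame.disagreement_nonneg _ _)]
        have : 0 ≤ 2 * √(CoalitionGame.disagreement f (x t) (w t)) * ‖x t - xstar‖ := by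
          positivity
        linarith
      have h7 := mul_le_mul_of_nonneg_right hU0 (Real.exp_pos (-(δ * t))).le
      linarith
    refine ⟨hchi, fun r hr => ?_⟩
    have hlim := ((hφ.tendsto_zero ‖CoalitionGame.chi f R xstar (x 0) (w 0)‖
      (norm_nonneg _)).comp (tendsto_id.const_mul_atTop hδ)).eventually
        (gt_mem_nhds (sub_pos.2 hr))
    filter_upwards [hlim, eventually_ge_atTop 0] with t h1 ht
    have h2 : ‖x t - xstar‖ ≤ ‖CoalitionGame.chi f R xstar (x t) (w t)‖ := by
      refine abs_le_of_sq_le_sq' ?_ (norm_nonneg _) |>.2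
      rw [CoalitionGame.norm_chi_sq hR]
      linarith [CoalitionGame.disagreement_nonneg (f := f) (x t) (w t)]
    have h3 := hchi t ht
    simp only [Function.comp_apply, id] at h1
    linarith
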